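/- Let $\mu$ be the uniform (fair-coin) measure on $2^{\omega}$. An *oracle machine* $M$ is a partial computable function $M(\sigma,n)$ of a binary string $\sigma$ and a number $n$, with values in $\mathbb{N}$, such that $M(\sigma,n)=M(\tau,n)$ whenever $\sigma\preceq\tau$ and both are defined; for $X\in 2^{\omega}$, $M(X)$ is the partial function on $\mathbb{N}$ with $M(X)(n)=M(X{\upharpoonright}k,n)$ for any $k$ for which this is defined. A *monotone machine* $N$ is a partial computable function from binary strings to binary strings such that $N(\sigma)\preceq N(\tau)$ whenever $\sigma\preceq\tau$ and both are defined; $N(X)$ is the supremum of all $N(\sigma)$ with $\sigma\prec X$. A class $S\subseteq 2^{\omega}$ is $\Sigma^0_2$ if $S=\{X : \exists a\,\forall b\; R(a,X{\upharpoonright}b)\}$ for some decidable $R$, and $\Pi^0_2$ if its complement is $\Sigma^0_2$. A real in $[0,1]$ is *3-random* if it has a binary expansion that is Martin-Löf random relative to $\emptyset''$. (a) For every oracle machine $M$, the class of $X$ such that $M(X)$ is (total and equal to) the characteristic sequence of a cofinite subset of $\mathbb{N}$ is the intersection of a $\Pi^0_2$ class and a $\Sigma^0_2$ class; its $\mu$-measure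 is a $\emptyset''$-computable real and is not 3-random. (b) For every oracle machine $M$, the class of $X$ such that $M(X)$ is a total computable function is measurable; its $\mu$-measure is a $\emptyset''$-computable real and is not 3-random. (c) For every monotone machine $N$, the class of $X$ such that $N(X)$ is an infinite stream with a tail of 1s is the intersection of a $\Pi^0_2$ class and a $\Sigma^0_2$ class; its $\mu$-measure is a $\emptyset''$-computable real and is not 3-random. (d) For every monotone machine $N$, the class of $X$ such that $N(X)$ is an infinite computable stream is measurable; its $\mu$-measure is a $\emptyset''$-computable real and is not 3-random. -/

import Mathlib

/-! ### Cantor space -/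

/-- Infinite binary sequences ("streams", the oracles and infinite inputs of the machines). -/
abbrev BinSeq : Type := ℕ → Bool

/-- The initial segment of `X` of length `k`. -/
def BinSeq.take (X : BinSeq) (k : ℕ) : List Bool := (List.range k).map X

/-- The uniform (fair coin) product measure on Cantor space. -/
noncomputable def coinMeasure : MeasureTheory.Measure BinSeq :=
  MeasureTheory.Measure.infinitePi fun _ : ℕ => (PMF.uniformOfFintype Bool).toMeasure

/-- A class of streams is `Σ⁰₂` if it has the form `{X | ∃ a, ∀ b, R(a, X ↾ b)}` with `R`
decidable (the length of the string `X ↾ b` carries the number `b`). -/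
def IsSigma02Class (S : Set BinSeq) : Prop :=
  ∃ R : ℕ × List Bool → Prop, ComputablePred R ∧ S = {X | ∃ a : ℕ, ∀ b : ℕ, R (a, X.take b)}

/-- `Π⁰₂` classes are the complements of `Σ⁰₂` classes. -/
def IsPi02Class (P : Set BinSeq) : Prop := IsSigma02Class Pᶜ

/-! ### Oracles and the Turing jump -/

open Classical in
/-- The characteristic sequence of a set of natural numbers. -/
noncomputable def charSeq (A : Set ℕ) : BinSeq := fun n => decide (n ∈ A)

/-- The family of oracles consisting only of the (numerical) characteristic function of `A`. -/
noncomputable def setOracle (A : Set ℕ) : Set (ℕ →. ℕ) :=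
  {fun n => Part.some (charSeq A n).toNat}

/-- A predicate is c.e. relative to `A` if it is the domain of a partial function
recursive in `A`. -/
def REPredIn (A : Set ℕ) {α : Type*} [Primcodable α] (p : α → Prop) : Prop :=
  RecursiveIn (setOracle A) fun a => Part.assert (p a) fun _ => Part.some ()

/-- The Turing jump of `A`, i.e. the halting problem relative to `A`: the set of `e` such that the
`e`-th c.e. operator `W_e` accepts `e` with oracle `A`.  Here the `e`-th c.e. operator accepts `x`
with oracle `A` if the `e`-th partial recursive function halts on input `(σ, x)`
for some initial segment `σ` of `A`. -/
noncomputable def turingJump (A : Set ℕ) : Set ℕ :=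
  {e | ∃ k : ℕ, ((Denumerable.ofNat Nat.Partrec.Code e).eval
    (Encodable.encode ((charSeq A).take k, e))).Dom}

/-- The second iterate `∅''` of the halting problem. -/
noncomputable def zeroDoubleJump : Set ℕ := turingJump (turingJump ∅)

/-- A real number is computable relative to `A` if, computably in `A`, it can be approximated
by a dyadic rational within `2⁻ⁿ`, for each `n`. -/
def IsComputableRealIn (A : Set ℕ) (α : ℝ) : Prop :=
  ∃ q : ℕ → ℤ, ComputableIn (setOracle A) q ∧ ∀ n, |α - (q n : ℝ) / 2 ^ n| ≤ 1 / 2 ^ n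

/-! ### Martin-Löf randomness -/

/-- A Martin-Löf test relative to `A`: a uniformly c.e. relative to `A` sequence of
`Σ⁰₁(A)` classes `U i` of measure at most `2⁻ⁱ`. -/
def IsMLTestIn (A : Set ℕ) (U : ℕ → Set BinSeq) : Prop :=
  (∃ W : ℕ × List Bool → Prop, REPredIn A W ∧ ∀ i, U i = {X | ∃ k : ℕ, W (i, X.take k)}) ∧
    ∀ i, coinMeasure (U i) ≤ (2⁻¹ : ENNReal) ^ i

/-- A stream is Martin-Löf random relative to `A` if it passes all tests relative to `A`. -/
def IsMLRandomIn (A : Set ℕ) (X : BinSeq) : Prop :=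
  ∀ U : ℕ → Set BinSeq, IsMLTestIn A U → X ∉ ⋂ i, U i

/-- The real number in `[0,1]` with binary expansion `X`. -/
noncomputable def binValue (X : BinSeq) : ℝ := ∑' i : ℕ, (if X i then (1 / 2 : ℝ) ^ (i + 1) else 0)

/-- A real number in `[0,1]` is 3-random if it has a binary expansion which is Martin-Löf random
relative to `∅''`. -/
def IsThreeRandomReal (α : ℝ) : Prop :=
  ∃ X : BinSeq, binValue X = α ∧ IsMLRandomIn zeroDoubleJump X

/-! ### Oracle machines -/

/-- An oracle machine, given as a partial computable function of a finite string of oracle bits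
and a numerical argument, whose values do not depend on how much of the oracle is supplied. -/
structure OracleMachine where
  toFun : List Bool → ℕ →. ℕ
  partrec : Partrec₂ toFun
  consistent : ∀ {σ τ : List Bool} {n a b : ℕ}, σ <+: τ → a ∈ toFun σ n → b ∈ toFun τ n → a = b

/-- With oracle `X`, the machine computes the total function `f`: for each `n`, the computation
`M(X, n)` halts with value `f n`. -/
def OracleMachine.Computes (M : OracleMachine) (X : BinSeq) (f : ℕ → ℕ) : Prop :=
  ∀ n, ∃ k, f n ∈ M.toFun (X.take k) n

/-- The oracles with which `M` computes the characteristic sequence of a cofinite set. -/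
def OracleMachine.cofiniteEvent (M : OracleMachine) : Set BinSeq :=
  {X | ∃ A : Set ℕ, Aᶜ.Finite ∧ M.Computes X fun n => (charSeq A n).toNat}

/-- The oracles with which `M` computes a total computable function. -/
def OracleMachine.computableEvent (M : OracleMachine) : Set BinSeq :=
  {X | ∃ f : ℕ → ℕ, Computable f ∧ M.Computes X f}

/-! ### Monotone machines -/

/-- A monotone machine: a partial computable function from strings to strings which is monotone
for the prefix relation on its domain. -/
structure MonotoneMachine where
  toFun : List Bool →. List Bool
  partrec : Partrec toFun
  monotone : ∀ {σ τ ρ π : List Bool}, σ <+: τ → ρ ∈ toFun σ → π ∈ toFun τ → ρ <+: π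

/-- The output `N(X)`, i.e. the supremum of all `N(σ)` with `σ` an initial segment of `X`,
is the (infinite) stream `f`. -/
def MonotoneMachine.Outputs (N : MonotoneMachine) (X f : BinSeq) : Prop :=
  (∀ k, ∀ ρ ∈ N.toFun (X.take k), ρ = f.take ρ.length) ∧
    ∀ n, ∃ k, ∃ ρ ∈ N.toFun (X.take k), n ≤ ρ.length

/-- The inputs on which the output of `N` is a stream with a tail of 1s. -/
def MonotoneMachine.cofiniteEvent (N : MonotoneMachine) : Set BinSeq :=
  {X | ∃ A : Set ℕ, Aᶜ.Finite ∧ N.Outputs X (charSeq A)}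

/-- The inputs on which the output of `N` is a computable stream. -/
def MonotoneMachine.computableEvent (N : MonotoneMachine) : Set BinSeq :=
  {X | ∃ f : BinSeq, Computable f ∧ N.Outputs X f}

/-! ### Oracle computability -/

section OracleComputability

open Encodable

variable {α β γ σ : Type*} [Primcodable α] [Primcodable β] [Primcodable γ] [Primcodable σ]
  {O : Set (ℕ →. ℕ)}

/-! Both kinds of machine are replaced by a `StagedMachine`, a primitive recursive approximation on
finite strings. Let `U m` be the effectively open class of oracles for which the first `m` values
are defined (and are bits, in the cofinite case). In either case the measure `α` of the event is
characterized by clopen tests `g c m`: `r ≤ α` holds once, for some `c` and all large `m`, some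
stage `L` gives the test measure at least `r`. Taken literally this is a `Σ⁰₃` condition, one
quantifier too many for `∅''`.

The criterion `isComputableRealIn_of_approx` removes that quantifier. The oracle `∅''` first finds
the infimum of the measures of the `U m` to precision `2⁻ᵏ`, since being below a bound is `Σ⁰₂`.
With this number known, "some stage `L`" becomes "every stage `L` at which the visible clopen part
of `U m` has reached the known measure", a guard under which at most `2⁻ᵏ` of `U m` is still missing
for large `m`. The condition is now `Σ⁰₂`, and `∅''` locates `α` by a search.

For cofinite outputs, `c` is a place after which no value other than 1 appears. For computable
outputs, a function computed with positive probability is computable by majority vote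
(`computable_of_measure_pos`), while the countably many computable functions of probability zero
contribute a null set. Hence the event is, up to a null set, the union of the atoms of the output
distribution, and the test asks that the first `m` values have mass at least `2⁻ᶜ` (`heavy`).

Finally, a real computable in `∅''` is not 3-random: its approximations leave boundedly many
candidates for each initial segment of an expansion, which gives a Martin-Löf test
(`not_isThreeRandomReal`). -/

theorem RecursiveIn.comp {f : β →. σ} {g : α → β} (hf : RecursiveIn O f)
    (hg : ComputableIn O g) : RecursiveIn O fun a => f (g a) :=
  (Nat.RecursiveIn.comp hf hg).of_eq fun n => by
    rcases e : decode (α := α) n with - | a <;> simp [encodek]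

theorem ComputableIn.comp {f : β → σ} {g : α → β} (hf : ComputableIn O f)
    (hg : ComputableIn O g) : ComputableIn O fun a => f (g a) :=
  RecursiveIn.comp (f := fun b => Part.some (f b)) hf hg

theorem ComputableIn.pair {f : α → β} {g : α → γ} (hf : ComputableIn O f)
    (hg : ComputableIn O g) : ComputableIn O fun a => (f a, g a) :=
  (Nat.RecursiveIn.pair hf hg).of_eq fun n => by
    rcases e : decode (α := α) n <;> simp [Seq.seq]

theorem ComputableIn.find {P : α → ℕ → Bool} (hP : ComputableIn O fun p : α × ℕ => P p.1 p.2)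
    (h : ∀ x, ∃ n, P x n = true) : ComputableIn O fun x => Nat.find (h x) := by
  -- `Nat.RecursiveIn.rfind` looks for a zero, so success is coded by 0.
  have hc : ComputableIn O fun p : α × ℕ => cond (P p.1 p.2) 0 1 :=
    ComputableIn.comp (Primrec.dom_bool fun b => cond b 0 1).computableIn hP
  refine (Nat.RecursiveIn.rfind hc).of_eq fun n => ?_
  rcases e : decode (α := α) n with - | a
  · refine (Nat.rfind_zero_none _ ?_).trans ?_ <;> simp [e]
  · have key : ∀ m, ((fun m : ℕ => decide (m = 0)) <$> (Part.bind
        (decode (α := α × ℕ) (Nat.pair n m) : Part (α × ℕ)) fun p =>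
          (Part.some (cond (P p.1 p.2) 0 1)).map encode)) = Part.some (P a m) := by
      intro m
      cases hm : P a m <;> simp [e, hm]
    refine (Part.eq_some_iff.2 (Nat.mem_rfind.2
      ⟨(Part.eq_some_iff.1 ((key _).trans ?_)), fun {m} hm => Part.eq_some_iff.1 ((key m).trans ?_)⟩
      : Nat.find (h a) ∈ _)).trans ?_
    · rw [Nat.find_spec (h a)]
    · rw [Bool.eq_false_iff.2 (Nat.find_min (h a) hm)]
    · simp

theorem computableIn_charSeq (A : Set ℕ) : ComputableIn (setOracle A) (charSeq A) := by
  have h1 : ComputableIn (setOracle A) fun n => (charSeq A n).toNat :=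
    RecursiveIn.oracle _ rfl
  have h2 : Primrec fun n : ℕ => decide (n = 1) :=
    (Primrec.eq.comp Primrec.id (Primrec.const 1)).decide
  refine RecursiveIn.of_eq (h2.computableIn.comp h1) fun n => ?_
  cases h : charSeq A n <;> simp [h]

/-- Many-one reducibility to `A` yields a characteristic function computable in `A`. -/
theorem computableIn_of_reducible {A : Set ℕ} {p : α → Bool} {h : α → ℕ} (hh : Computable h)
    (hp : ∀ x, h x ∈ A ↔ p x = true) : ComputableIn (setOracle A) p := by
  refine RecursiveIn.of_eq ((computableIn_charSeq A).comp hh.computableIn) fun x => ?_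
  congr 1
  by_cases hx : h x ∈ A
  · simp [charSeq, hx, (hp x).1 hx]
  · have := mt (hp x).2 hx
    simp [charSeq, hx, Bool.eq_false_iff.2 this]

theorem REPredIn.of_computableIn {A : Set ℕ} {p : α → Prop} {f : α → Bool}
    (hf : ComputableIn (setOracle A) f) (hp : ∀ a, p a ↔ f a = true) : REPredIn A p := by
  have h : Partrec fun b : Bool => Part.assert (b = true) fun _ => Part.some () :=
    ComputablePred.to_re (p := fun b : Bool => b = true)
      ((Primrec.eq.comp Primrec.id (Primrec.const true)).computablePred)
  exact RecursiveIn.of_eq (RecursiveIn.comp h.recursiveIn hf) fun a => by rw [propext (hp a)]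

/-! ### The Turing jump -/

/-- Every c.e. operator is uniformly reducible to the jump of its oracle. -/
theorem turingJump_reducible (A : Set ℕ) {p : α → List Bool → Prop}
    (hp : REPred fun q : α × List Bool => p q.1 q.2) :
    ∃ h : α → ℕ, Computable h ∧ ∀ x, h x ∈ turingJump A ↔ ∃ k, p x ((charSeq A).take k) := by
  -- The last component is the index that the jump feeds to its own code. It is ignored, so the code
  -- obtained by currying in `x` accepts independently of its index.
  have hF : Partrec fun q : α × (List Bool × ℕ) =>
      Part.assert (p q.1 q.2.1) fun _ => Part.some () :=
    Partrec.comp (g := fun q : α × (List Bool × ℕ) => (q.1, q.2.1)) hp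
      (Primrec.fst.pair (Primrec.fst.comp Primrec.snd)).to_comp
  obtain ⟨c, hc⟩ := Nat.Partrec.Code.exists_code.1 hF
  refine ⟨fun x => encode (Nat.Partrec.Code.curry c (encode x)),
    (Primrec.encode.comp (Nat.Partrec.Code.primrec₂_curry.comp (Primrec.const c)
      Primrec.encode)).to_comp, fun x => ?_⟩
  simp only [turingJump, Set.mem_ofPred_eq, Denumerable.ofNat_encode,
    Nat.Partrec.Code.eval_curry]
  refine exists_congr fun k => ?_
  rw [← encode_prod_val, hc]
  simp [Part.assert]

theorem rePred_exists {p : α → ℕ → Bool} (hp : Computable fun q : α × ℕ => p q.1 q.2) :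
    REPred fun x => ∃ n, p x n = true := by
  have : Partrec fun x => Nat.rfind fun n => Part.some (p x n) :=
    Partrec.rfind hp.partrec
  refine this.dom_re.of_eq fun x => ?_
  refine (Nat.rfind_dom' (p := fun n => Part.some (p x n))).trans ?_
  exact ⟨fun ⟨n, h, _⟩ => ⟨n, (Part.mem_some_iff.1 h).symm⟩,
    fun ⟨n, h⟩ => ⟨n, Part.mem_some_iff.2 h.symm, fun _ => trivial⟩⟩

@[simp] theorem BinSeq.length_take (X : BinSeq) (k : ℕ) : (X.take k).length = k := by
  simp [BinSeq.take]

theorem BinSeq.take_getElem? (X : BinSeq) (k i : ℕ) :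
    (X.take k)[i]? = if i < k then some (X i) else none := by
  by_cases h : i < k <;> simp [BinSeq.take, h]

/-- `Σ⁰₂` predicates are many-one reducible to `∅''`. -/
theorem zeroDoubleJump_reducible {R : α → ℕ → ℕ → Bool}
    (hR : Computable fun q : (α × ℕ) × ℕ => R q.1.1 q.1.2 q.2) :
    ∃ h : α → ℕ, Computable h ∧ ∀ x, h x ∈ zeroDoubleJump ↔ ∃ a, ∀ b, R x a b = true := by
  have h1 : REPred fun q : (α × ℕ) × List Bool => ∃ b, (!R q.1.1 q.1.2 b) = true :=
    rePred_exists (p := fun (q : (α × ℕ) × List Bool) b => !R q.1.1 q.1.2 b)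
      (Primrec.not.to_comp.comp (hR.comp (g := fun q : ((α × ℕ) × List Bool) × ℕ => (q.1.1, q.2))
        ((Computable.fst.comp Computable.fst).pair Computable.snd)))
  obtain ⟨g, hg, hg'⟩ := turingJump_reducible ∅
    (p := fun (q : α × ℕ) _ => ∃ b, (!R q.1 q.2 b) = true) h1
  -- The string stands for an initial segment of `∅'`. The test asks that it be long enough to
  -- contain the bit at `g (x, a)` and that this bit deny membership, which is the `∀ b` statement.
  have h2 : REPred fun q : α × List Bool => ∃ a, decide (q.2[g (q.1, a)]? = some false) = true :=
    rePred_exists (p := fun (q : α × List Bool) a => decide (q.2[g (q.1, a)]? = some false))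
      ((Primrec.eq.decide.to_comp).comp (Computable.list_getElem?.comp
        (Computable.snd.comp Computable.fst)
        (hg.comp ((Computable.fst.comp Computable.fst).pair Computable.snd)))
        (Computable.const _))
  obtain ⟨h, hh, hh'⟩ := turingJump_reducible (turingJump ∅)
    (p := fun x σ => ∃ a, decide (σ[g (x, a)]? = some false) = true) h2
  refine ⟨h, hh, fun x => (hh' x).trans ?_⟩
  rw [exists_comm]
  refine exists_congr fun a => ?_
  have key : g (x, a) ∉ turingJump ∅ ↔ ∀ b, R x a b = true := by
    rw [hg']; simp
  rw [← key]
  constructor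
  · rintro ⟨k, hk⟩
    rw [decide_eq_true_eq, BinSeq.take_getElem?] at hk
    split_ifs at hk
    simpa [charSeq] using hk
  · intro hn
    refine ⟨g (x, a) + 1, ?_⟩
    rw [decide_eq_true_eq, BinSeq.take_getElem?]
    simp [charSeq, hn]

open Classical in
theorem computableIn_zeroDoubleJump {R : α → ℕ → ℕ → Bool}
    (hR : Computable fun q : (α × ℕ) × ℕ => R q.1.1 q.1.2 q.2) :
    ComputableIn (setOracle zeroDoubleJump) fun x => decide (∃ a, ∀ b, R x a b = true) := by
  obtain ⟨h, hh, hh'⟩ := zeroDoubleJump_reducible hR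
  exact computableIn_of_reducible hh fun x => by simp [hh']

end OracleComputability

/-! ### The coin measure of clopen classes -/

section CoinMeasure

open MeasureTheory

/-- The list of all binary strings of length `L`. -/
def binStrings : ℕ → List (List Bool)
  | 0 => [[]]
  | L + 1 => (binStrings L).flatMap fun σ => [σ ++ [false], σ ++ [true]]

theorem mem_binStrings {L : ℕ} {σ : List Bool} : σ ∈ binStrings L ↔ σ.length = L := by
  induction L generalizing σ with
  | zero => simp [binStrings]
  | succ L ih =>
    simp only [binStrings, List.mem_flatMap, ih]
    constructor
    · rintro ⟨τ, rfl, h⟩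
      simp only [List.mem_cons, List.not_mem_nil, or_false] at h
      rcases h with rfl | rfl <;> simp
    · intro h
      rcases List.eq_nil_or_concat σ with rfl | ⟨τ, b, rfl⟩
      · simp at h
      · refine ⟨τ, by simpa using h, ?_⟩
        cases b <;> simp

theorem nodup_binStrings (L : ℕ) : (binStrings L).Nodup := by
  induction L with
  | zero => simp [binStrings]
  | succ L ih =>
    refine List.nodup_flatMap.2 ⟨fun σ _ => by simp, ?_⟩
    refine ih.imp fun {σ τ} h => ?_
    simp [Function.onFun, h.symm]

theorem primrec_binStrings : Primrec binStrings := by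
  have : Primrec₂ fun (_ : ℕ) (l : List (List Bool)) =>
      l.flatMap fun σ => [σ ++ [false], σ ++ [true]] := by
    refine Primrec.list_flatMap Primrec.snd ?_
    have hb : ∀ b : Bool, Primrec fun q : (ℕ × List (List Bool)) × List Bool => q.2 ++ [b] :=
      fun b => Primrec.list_concat.comp Primrec.snd (Primrec.const b)
    exact Primrec.list_cons.comp (hb false) (Primrec.list_cons.comp (hb true) (Primrec.const []))
  exact (Primrec.nat_rec₁ [[]] this).of_eq fun L => by
      induction L with
      | zero => rfl
      | succ L ih => simp [binStrings, ← ih]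

/-- The number of strings of length `L` accepted by `p`. -/
def countStrings (p : List Bool → Bool) (L : ℕ) : ℕ := ((binStrings L).filter p).length

theorem primrec_filter_length {α β : Type*} [Primcodable α] [Primcodable β] {f : α → List β}
    {p : α → β → Bool} (hf : Primrec f) (hp : Primrec₂ p) :
    Primrec fun a => ((f a).filter (p a)).length := by
  have : Primrec₂ fun a b => cond (p a b) (some b) none :=
    Primrec.cond hp (Primrec.option_some.comp Primrec.snd) (Primrec.const none)
  refine (Primrec.list_length.comp (Primrec.listFilterMap hf this)).of_eq fun a => ?_
  rw [← List.filterMap_eq_filter]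
  congr 2
  funext b
  cases h : p a b <;> simp [Option.guard, h]

theorem primrec_countStrings {α : Type*} [Primcodable α] {f : α → ℕ}
    {p : α → List Bool → Bool} (hp : Primrec₂ p) (hf : Primrec f) :
    Primrec fun a => countStrings (p a) (f a) :=
  primrec_filter_length (primrec_binStrings.comp hf) hp

theorem primrec_all {α β : Type*} [Primcodable α] [Primcodable β] {f : α → List β}
    {p : α → β → Bool} (hf : Primrec f) (hp : Primrec₂ p) :
    Primrec fun a => (f a).all (p a) := by
  have := (Primrec.eq.comp (primrec_filter_length hf (Primrec.not.comp₂ hp))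
    (Primrec.const 0)).decide
  refine this.of_eq fun a => ?_
  rw [Bool.eq_iff_iff]
  simp [List.filter_eq_nil_iff]

instance : IsProbabilityMeasure coinMeasure := by
  unfold coinMeasure; infer_instance

theorem setOf_take_eq (σ : List Bool) : {X : BinSeq | X.take σ.length = σ} =
    ((Finset.range σ.length : Finset ℕ) : Set ℕ).pi fun i => {σ.getD i false} := by
  ext X
  simp only [Set.mem_ofPred_eq, Set.mem_pi, Finset.coe_range, Set.mem_Iio, Set.mem_singleton_iff]
  constructor
  · intro h i hi
    rw [List.getD_eq_getElem?_getD, ← h, BinSeq.take_getElem?]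
    simp [hi]
  · intro h
    refine List.ext_getElem (by simp) fun i h1 h2 => ?_
    have := h i h2
    rw [List.getD_eq_getElem _ _ h2] at this
    simp [BinSeq.take, this]

theorem measurableSet_take (L : ℕ) (p : List Bool → Prop) :
    MeasurableSet {X : BinSeq | p (X.take L)} := by
  have : {X : BinSeq | p (X.take L)} =
      ⋃ σ ∈ {σ : List Bool | p σ ∧ σ.length = L}, {X : BinSeq | X.take σ.length = σ} := by
    ext X
    simp only [Set.mem_ofPred_eq, Set.mem_iUnion, exists_prop]
    constructor
    · intro h
      exact ⟨X.take L, ⟨h, by simp⟩, by simp⟩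
    · rintro ⟨σ, ⟨h, rfl⟩, h'⟩
      rwa [h']
  rw [this]
  refine MeasurableSet.biUnion (Set.to_countable _) fun σ _ => ?_
  rw [setOf_take_eq]
  exact MeasurableSet.pi (Set.to_countable _) fun i _ => measurableSet_singleton _

theorem measurableSet_exists_take (p : ℕ → List Bool → Prop) :
    MeasurableSet {X : BinSeq | ∃ L, p L (X.take L)} := by
  rw [Set.ofPred_exists]
  exact MeasurableSet.iUnion fun L => measurableSet_take L (p L)

theorem coinMeasure_cylinder (σ : List Bool) :
    coinMeasure {X | X.take σ.length = σ} = 2⁻¹ ^ σ.length := by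
  rw [setOf_take_eq, coinMeasure, Measure.infinitePi_pi _ fun i _ => measurableSet_singleton _]
  simp

theorem coinMeasure_real_cylinder (σ : List Bool) :
    coinMeasure.real {X | X.take σ.length = σ} = 1 / 2 ^ σ.length := by
  rw [measureReal_def, coinMeasure_cylinder]
  simp

theorem coinMeasure_real_take (p : List Bool → Bool) (L : ℕ) :
    coinMeasure.real {X | p (X.take L) = true} = countStrings p L / 2 ^ L := by
  have h1 : {X : BinSeq | p (X.take L) = true} =
      ⋃ σ ∈ ((binStrings L).filter p).toFinset, {X : BinSeq | X.take σ.length = σ} := by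
    ext X
    simp only [Set.mem_ofPred_eq, Set.mem_iUnion, exists_prop, List.mem_toFinset, List.mem_filter,
      mem_binStrings]
    constructor
    · intro h
      exact ⟨X.take L, ⟨by simp, h⟩, by simp⟩
    · rintro ⟨σ, ⟨rfl, h⟩, h'⟩
      rwa [h']
  have hlen : ∀ σ ∈ ((binStrings L).filter p).toFinset, σ.length = L := by
    intro σ hσ
    simp only [List.mem_toFinset, List.mem_filter, mem_binStrings] at hσ
    exact hσ.1
  rw [h1, measureReal_biUnion_finset]
  · rw [Finset.sum_congr rfl fun σ hσ => by rw [coinMeasure_real_cylinder, hlen σ hσ]]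
    rw [Finset.sum_const, List.toFinset_card_of_nodup ((nodup_binStrings L).filter _)]
    simp [countStrings, div_eq_mul_inv]
  · intro σ hσ τ hτ hne
    refine Set.disjoint_left.2 fun X hX hX' => hne ?_
    rw [Set.mem_ofPred_eq, hlen σ hσ] at hX
    rw [Set.mem_ofPred_eq, hlen τ hτ] at hX'
    exact hX.symm.trans hX'
  · intro σ _
    exact measurableSet_take _ (fun τ => τ = σ)

/-- Translates between integer counts, which are primitive recursive, and measures, for which
continuity is available. -/
theorem countStrings_eq (p : List Bool → Bool) (L : ℕ) :
    (countStrings p L : ℝ) = coinMeasure.real {X | p (X.take L) = true} * 2 ^ L := by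
  rw [coinMeasure_real_take]
  field_simp

theorem countStrings_le (p : List Bool → Bool) (L : ℕ) : countStrings p L ≤ 2 ^ L := by
  have h : (countStrings p L : ℝ) ≤ 2 ^ L := by
    rw [countStrings_eq]
    exact mul_le_of_le_one_left (by positivity) measureReal_le_one
  exact_mod_cast h

/-! ### Computable reals are not random -/

/-- The number with the given binary digits, the most significant one first. -/
def binNat (σ : List Bool) : ℕ := σ.foldl (fun a b => 2 * a + b.toNat) 0

theorem binNat_concat (σ : List Bool) (b : Bool) : binNat (σ ++ [b]) = 2 * binNat σ + b.toNat := by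
  simp [binNat]

theorem primrec_binNat : Primrec binNat := by
  refine Primrec.list_foldl (α := List Bool) (β := Bool) (σ := ℕ) Primrec.id (Primrec.const 0)
    (h := fun _ p => 2 * p.1 + p.2.toNat) ?_
  exact Primrec.nat_add.comp (Primrec.nat_mul.comp (Primrec.const 2)
    (Primrec.fst.comp Primrec.snd)) ((Primrec.dom_bool _).comp (Primrec.snd.comp Primrec.snd))

theorem binNat_injective {σ τ : List Bool} (h : σ.length = τ.length) (hv : binNat σ = binNat τ) :
    σ = τ := by
  induction σ using List.reverseRecOn generalizing τ with
  | nil => exact (List.length_eq_zero_iff.1 h.symm).symm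
  | append_singleton σ b ih =>
    rcases List.eq_nil_or_concat τ with rfl | ⟨τ, d, rfl⟩
    · simp at h
    · rw [List.concat_eq_append] at h hv ⊢
      rw [binNat_concat, binNat_concat] at hv
      have : b = d := by
        cases b <;> cases d <;> simp at hv ⊢ <;> omega
      subst this
      rw [ih (by simpa using h) (by omega)]

theorem BinSeq.take_succ (X : BinSeq) (L : ℕ) : X.take (L + 1) = X.take L ++ [X L] := by
  simp [BinSeq.take, List.range_succ]

/-- The first `L` digits sum exactly to the dyadic rational, and the remaining digits are dominated
by a geometric series with sum `2⁻ᴸ`. -/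
theorem abs_binValue_sub_le (X : BinSeq) (L : ℕ) :
    |binValue X - binNat (X.take L) / 2 ^ L| ≤ 1 / 2 ^ L := by
  set f : ℕ → ℝ := fun i => if X i then (1 / 2 : ℝ) ^ (i + 1) else 0 with hf
  have h0 : ∀ i, 0 ≤ f i := fun i => by simp only [hf]; split_ifs <;> positivity
  have h1 : ∀ i, f i ≤ (1 / 2 : ℝ) ^ (i + 1) := fun i => by
    simp only [hf]; split_ifs
    · exact le_rfl
    · positivity
  have hg : ∀ L, HasSum (fun i => (1 / 2 : ℝ) ^ (i + L + 1)) (1 / 2 ^ L) := fun L => by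
    have := (hasSum_geometric_of_lt_one (r := (1 / 2 : ℝ)) (by norm_num) (by norm_num)).mul_right
      ((1 / 2 : ℝ) ^ (L + 1))
    rw [show (1 - 1 / 2 : ℝ)⁻¹ * (1 / 2) ^ (L + 1) = 1 / 2 ^ L by
      rw [one_div_pow, pow_succ]; field_simp; norm_num] at this
    refine this.congr_fun fun i => ?_
    ring
  have hs : Summable f := Summable.of_nonneg_of_le h0 h1 (by simpa using (hg 0).summable)
  have hsum : ∀ L, ∑ i ∈ Finset.range L, f i = binNat (X.take L) / 2 ^ L := by
    intro L
    induction L with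
    | zero => simp [BinSeq.take, binNat]
    | succ L ih =>
      rw [Finset.sum_range_succ, ih, BinSeq.take_succ, binNat_concat, hf]
      cases hX : X L <;> (simp [hX]; field_simp; ring)
  have htail := hs.sum_add_tsum_nat_add L
  have hb : binValue X = ∑' i, f i := rfl
  rw [hb, ← htail, hsum, add_sub_cancel_left, abs_of_nonneg (tsum_nonneg fun i => h0 _)]
  exact (((summable_nat_add_iff L).2 hs).tsum_le_tsum (fun i => h1 _) (hg L).summable).trans_eq
    (hg L).tsum_eq

/-- The encoding of `ℤ` sends nonnegative integers to even numbers and negative ones to odd numbers,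
so a parity test and halving suffice. -/
theorem primrec_int_toNat : Primrec Int.toNat := by
  have : Primrec fun n : ℕ => cond (n.bodd) 0 n.div2 :=
    Primrec.cond Primrec.nat_bodd (Primrec.const 0) Primrec.nat_div2
  refine (this.comp Primrec.encode).of_eq fun z => ?_
  cases z with
  | ofNat n =>
    have : Encodable.encode (n : ℤ) = 2 * n := rfl
    simp [this]
  | negSucc n =>
    have : Encodable.encode (Int.negSucc n) = 2 * n + 1 := rfl
    simp [this]

theorem primrec_int_ofNat : Primrec fun n : ℕ => (n : ℤ) := by
  refine Primrec.encode_iff.1 ((Primrec.nat_mul.comp (Primrec.const 2) Primrec.id).of_eq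
    fun n => ?_)
  rfl

/-- At precision `i + 3`, the given approximation and the truncated expansion each differ from the
real by at most one unit in the last place, so they differ from each other by at most two units. The
strings this close to the approximation form the `i`-th level of a test that captures `X`. -/
theorem not_isThreeRandomReal {α : ℝ} (h0 : 0 ≤ α) (h : IsComputableRealIn zeroDoubleJump α) :
    ¬ IsThreeRandomReal α := by
  rintro ⟨X, rfl, hX⟩
  obtain ⟨q, hq, hq'⟩ := h
  -- Truncating a negative approximation to 0 is harmless, because it is only compared with natural
  -- numbers.
  set t : ℕ → ℕ := fun i => (q (i + 3)).toNat with ht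
  have htc : ComputableIn (setOracle zeroDoubleJump) t :=
    primrec_int_toNat.computableIn.comp (hq.comp
      (Primrec.nat_add.comp Primrec.id (Primrec.const 3)).computableIn)
  set W : ℕ × List Bool → Prop := fun p =>
    p.2.length = p.1 + 3 ∧ binNat p.2 ≤ t p.1 + 2 ∧ t p.1 ≤ binNat p.2 + 2 with hW
  refine hX (fun i => {Y | ∃ k, W (i, Y.take k)}) ⟨⟨W, ?_, fun i => rfl⟩, fun i => ?_⟩ ?_
  · have hp : Primrec fun p : ℕ × (ℕ × List Bool) => decide (p.2.2.length = p.2.1 + 3 ∧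
        binNat p.2.2 ≤ p.1 + 2 ∧ p.1 ≤ binNat p.2.2 + 2) := by
      have hv : Primrec fun p : ℕ × (ℕ × List Bool) => binNat p.2.2 :=
        primrec_binNat.comp (Primrec.snd.comp Primrec.snd)
      have h2 : ∀ {f : ℕ × (ℕ × List Bool) → ℕ} (n : ℕ), Primrec f → Primrec fun p => f p + n :=
        fun n hf => Primrec.nat_add.comp hf (Primrec.const n)
      exact ((Primrec.eq.comp (Primrec.list_length.comp (Primrec.snd.comp Primrec.snd))
        (h2 3 (Primrec.fst.comp Primrec.snd))).and
        ((Primrec.nat_le.comp hv (h2 2 Primrec.fst)).and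
        (Primrec.nat_le.comp Primrec.fst (h2 2 hv)))).decide
    exact REPredIn.of_computableIn (hp.computableIn.comp
      ((htc.comp ComputableIn.fst).pair ComputableIn.id)) fun a => by simp [hW]
  · have hsub : {Y : BinSeq | ∃ k, W (i, Y.take k)} ⊆
        ⋃ a ∈ Finset.Icc (t i - 2) (t i + 2), {Y : BinSeq | binNat (Y.take (i + 3)) = a} := by
      rintro Y ⟨k, hk, h1, h2⟩
      simp only [BinSeq.length_take] at hk
      subst hk
      simp only [Set.mem_iUnion, Finset.mem_Icc, Set.mem_ofPred_eq, exists_prop]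
      exact ⟨_, ⟨by dsimp only at h2; exact Nat.sub_le_iff_le_add.2 h2, h1⟩, rfl⟩
    have hone : ∀ a : ℕ, coinMeasure {Y : BinSeq | binNat (Y.take (i + 3)) = a} ≤ 2⁻¹ ^ (i + 3) := by
      intro a
      by_cases hne : ∃ σ : List Bool, σ.length = i + 3 ∧ binNat σ = a
      · obtain ⟨σ, hσ, rfl⟩ := hne
        rw [← hσ, ← coinMeasure_cylinder]
        refine measure_mono fun Y hY => ?_
        exact binNat_injective (by simp) hY
      · have : {Y : BinSeq | binNat (Y.take (i + 3)) = a} = ∅ := by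
          ext Y
          simp only [Set.mem_ofPred_eq, Set.mem_empty_iff_false, iff_false]
          exact fun hY => hne ⟨_, by simp, hY⟩
        simp [this]
    calc coinMeasure {Y : BinSeq | ∃ k, W (i, Y.take k)}
        ≤ ∑ a ∈ Finset.Icc (t i - 2) (t i + 2),
          coinMeasure {Y : BinSeq | binNat (Y.take (i + 3)) = a} :=
          (measure_mono hsub).trans (measure_biUnion_finset_le _ _)
      _ ≤ ∑ a ∈ Finset.Icc (t i - 2) (t i + 2), 2⁻¹ ^ (i + 3) := Finset.sum_le_sum fun a _ => hone a
      -- At most five values are allowed; the three extra digits pay for up to `8 = 2 ^ 3`.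
      _ ≤ 8 * 2⁻¹ ^ (i + 3) := by
          rw [Finset.sum_const, nsmul_eq_mul]
          gcongr
          have : (Finset.Icc (t i - 2) (t i + 2)).card ≤ 8 := by simp; omega
          exact_mod_cast this
      _ = 2⁻¹ ^ i := by
          rw [pow_add, mul_comm, mul_assoc]
          have : (2⁻¹ : ENNReal) ^ 3 * 8 = 1 := by
            rw [← ENNReal.inv_pow]
            norm_num
            exact ENNReal.inv_mul_cancel (by norm_num) (by norm_num)
          rw [this, mul_one]
  · refine Set.mem_iInter.2 fun i => ⟨i + 3, by simp, ?_⟩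
    have e1 := abs_le.1 (abs_binValue_sub_le X (i + 3))
    have e2 := abs_le.1 (hq' (i + 3))
    have hpos : (0 : ℝ) < 2 ^ (i + 3) := by positivity
    have a1 : (q (i + 3) : ℝ) ≤ binNat (X.take (i + 3)) + 2 := by
      have : (q (i + 3) : ℝ) / 2 ^ (i + 3) ≤ (binNat (X.take (i + 3)) + 2 : ℝ) / 2 ^ (i + 3) := by
        rw [add_div]
        have : (2 : ℝ) / 2 ^ (i + 3) = 1 / 2 ^ (i + 3) + 1 / 2 ^ (i + 3) := by ring
        linarith [e1.1, e1.2, e2.1, e2.2]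
      exact (div_le_div_iff_of_pos_right hpos).1 this
    have a2 : (binNat (X.take (i + 3)) : ℝ) ≤ q (i + 3) + 2 := by
      have : (binNat (X.take (i + 3)) : ℝ) / 2 ^ (i + 3) ≤ (q (i + 3) + 2 : ℝ) / 2 ^ (i + 3) := by
        rw [add_div]
        have : (2 : ℝ) / 2 ^ (i + 3) = 1 / 2 ^ (i + 3) + 1 / 2 ^ (i + 3) := by ring
        linarith [e1.1, e1.2, e2.1, e2.2]
      exact (div_le_div_iff_of_pos_right hpos).1 this
    have b1 : q (i + 3) ≤ (binNat (X.take (i + 3)) : ℤ) + 2 := by exact_mod_cast a1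
    have b2 : (binNat (X.take (i + 3)) : ℤ) ≤ q (i + 3) + 2 := by exact_mod_cast a2
    simp only [ht]
    omega

end CoinMeasure

/-! ### A criterion for computability relative to `∅''` -/

section Criterion

open MeasureTheory Filter

theorem primrec_nat_pow : Primrec₂ ((· ^ ·) : ℕ → ℕ → ℕ) :=
  Primrec₂.unpaired'.1 Nat.Primrec.pow

theorem BinSeq.take_take (X : BinSeq) {k l : ℕ} (h : k ≤ l) : (X.take l).take k = X.take k := by
  simp [BinSeq.take, ← List.map_take, List.take_range, min_eq_left h]

theorem BinSeq.take_prefix (X : BinSeq) {k l : ℕ} (h : k ≤ l) : X.take k <+: X.take l := by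
  rw [← X.take_take h]
  exact List.take_prefix _ _

theorem monotone_setOf_take {p : List Bool → Prop} (hp : ∀ {σ τ}, σ <+: τ → p σ → p τ) :
    Monotone fun L => {X : BinSeq | p (X.take L)} :=
  fun _ _ h X hX => hp (X.take_prefix h) hX

theorem coinMeasure_real_exists_take_le {p : List Bool → Bool} {r : ℝ}
    (hp : ∀ {σ τ}, σ <+: τ → p σ = true → p τ = true)
    (h : ∀ L, (countStrings p L : ℝ) ≤ r * 2 ^ L) :
    coinMeasure.real {X | ∃ L, p (X.take L) = true} ≤ r := by
  rw [Set.ofPred_exists]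
  have ht := tendsto_measure_iUnion_atTop (μ := coinMeasure)
    (monotone_setOf_take (p := fun σ => p σ = true) hp)
  refine le_of_tendsto ((ENNReal.tendsto_toReal (measure_ne_top _ _)).comp ht)
    (Eventually.of_forall fun L => ?_)
  change coinMeasure.real _ ≤ r
  rw [coinMeasure_real_take]
  exact div_le_of_le_mul₀ (by positivity) (by
    have := h 0
    have h' : (0 : ℝ) ≤ countStrings p 0 := by positivity
    simpa using h'.trans this) (h L)

theorem primrec_countStrings_comp {α : Type*} [Primcodable α] {g : ℕ → ℕ → List Bool → Bool}
    (hg : Primrec fun q : (ℕ × ℕ) × List Bool => g q.1.1 q.1.2 q.2) {f₁ f₂ f₃ : α → ℕ}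
    (h₁ : Primrec f₁) (h₂ : Primrec f₂) (h₃ : Primrec f₃) :
    Primrec fun a => countStrings (g (f₁ a) (f₂ a)) (f₃ a) :=
  primrec_countStrings (p := fun a σ => g (f₁ a) (f₂ a) σ)
    (hg.comp (g := fun r : α × List Bool => ((f₁ r.1, f₂ r.1), r.2))
      (((h₁.comp Primrec.fst).pair (h₂.comp Primrec.fst)).pair Primrec.snd)) h₃

/-- Let `U m = {X | ∃ L, d m (X ↾ L)}` be a decreasing sequence of effectively open classes.
A real `α ≥ 0` is computable in `∅''` if it is approximated by the measures of the decidable clopen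
classes `{X | g c m (X ↾ L)}` in the sense of `sound` and `complete`. -/
theorem isComputableRealIn_of_approx {α : ℝ} (h0 : 0 ≤ α)
    {d : ℕ → List Bool → Bool} {g : ℕ → ℕ → List Bool → Bool}
    (hd : Primrec₂ d) (hg : Primrec fun q : (ℕ × ℕ) × List Bool => g q.1.1 q.1.2 q.2)
    (hanti : ∀ {m m' σ}, m ≤ m' → d m' σ = true → d m σ = true)
    (hmono : ∀ {m σ τ}, σ <+: τ → d m σ = true → d m τ = true)
    (sound : ∀ (c m₀ : ℕ) (r : ℝ),
      (∀ m ≥ m₀, ∃ L, r * 2 ^ L ≤ countStrings (g c m) L) → r ≤ α)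
    (complete : ∀ r ε : ℝ, 0 < ε → r + 2 * ε < α → ∃ c, ∀ m L,
      coinMeasure.real {X | ∃ L, d m (X.take L) = true} ≤ countStrings (d m) L / 2 ^ L + ε →
        r * 2 ^ L ≤ countStrings (g c m) L) :
    IsComputableRealIn zeroDoubleJump α := by
  classical
  -- `R₁` says that the clopen approximations to `U m` have measure less than `(p + 1) / 2 ^ k`
  let R₁ : ℕ × ℕ → ℕ → ℕ → Bool := fun x m L =>
    !decide ((x.2 + 1) * 2 ^ L ≤ 2 ^ x.1 * countStrings (d m) L)
  have hR₁ : Computable fun q : ((ℕ × ℕ) × ℕ) × ℕ => R₁ q.1.1 q.1.2 q.2 := by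
    have hx : Primrec fun q : ((ℕ × ℕ) × ℕ) × ℕ => q.1.1 := Primrec.fst.comp Primrec.fst
    have hcd : Primrec fun q : ((ℕ × ℕ) × ℕ) × ℕ => countStrings (d q.1.2) q.2 :=
      primrec_countStrings (p := fun (q : ((ℕ × ℕ) × ℕ) × ℕ) σ => d q.1.2 σ)
        (hd.comp (Primrec.snd.comp (Primrec.fst.comp Primrec.fst)) Primrec.snd) Primrec.snd
    have h1 : Primrec fun q : ((ℕ × ℕ) × ℕ) × ℕ => (q.1.1.2 + 1) * 2 ^ q.2 :=
      Primrec.nat_mul.comp (Primrec.succ.comp (Primrec.snd.comp hx))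
        (primrec_nat_pow.comp (Primrec.const 2) Primrec.snd)
    have h2 : Primrec fun q : ((ℕ × ℕ) × ℕ) × ℕ => 2 ^ q.1.1.1 * countStrings (d q.1.2) q.2 :=
      Primrec.nat_mul.comp (primrec_nat_pow.comp (Primrec.const 2) (Primrec.fst.comp hx)) hcd
    exact (Primrec.not.comp (Primrec.nat_le.comp h1 h2).decide).to_comp
  -- With `x = ((k, p), j)`, `a` coding `(c, m₀)` and `b` coding `(m, L)`: if `m₀ ≤ m` and the
  -- stage-`L` part of `U m` has measure at least `p / 2 ^ k`, then the test `g c m` at stage `L`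
  -- has measure at least `(j + 1) / 2 ^ k`. The guard stands in for an existential quantifier over
  -- `L`.
  let R₂ : (ℕ × ℕ) × ℕ → ℕ → ℕ → Bool := fun x a b =>
    !decide (a.unpair.2 ≤ b.unpair.1) ||
      (!decide (x.1.2 * 2 ^ b.unpair.2 ≤ 2 ^ x.1.1 * countStrings (d b.unpair.1) b.unpair.2) ||
        decide ((x.2 + 1) * 2 ^ b.unpair.2 ≤
          2 ^ x.1.1 * countStrings (g a.unpair.1 b.unpair.1) b.unpair.2))
  have hR₂ : Computable fun q : (((ℕ × ℕ) × ℕ) × ℕ) × ℕ => R₂ q.1.1 q.1.2 q.2 := by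
    have hx : Primrec fun q : (((ℕ × ℕ) × ℕ) × ℕ) × ℕ => q.1.1 := Primrec.fst.comp Primrec.fst
    have ha : Primrec fun q : (((ℕ × ℕ) × ℕ) × ℕ) × ℕ => q.1.2.unpair :=
      Primrec.unpair.comp (Primrec.snd.comp Primrec.fst)
    have hb : Primrec fun q : (((ℕ × ℕ) × ℕ) × ℕ) × ℕ => q.2.unpair :=
      Primrec.unpair.comp Primrec.snd
    have hp : Primrec fun q : (((ℕ × ℕ) × ℕ) × ℕ) × ℕ => 2 ^ q.2.unpair.2 :=
      primrec_nat_pow.comp (Primrec.const 2) (Primrec.snd.comp hb)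
    have hk : Primrec fun q : (((ℕ × ℕ) × ℕ) × ℕ) × ℕ => 2 ^ q.1.1.1.1 :=
      primrec_nat_pow.comp (Primrec.const 2) (Primrec.fst.comp (Primrec.fst.comp hx))
    have hcd : Primrec fun q : (((ℕ × ℕ) × ℕ) × ℕ) × ℕ =>
        countStrings (d q.2.unpair.1) q.2.unpair.2 :=
      primrec_countStrings (hd.comp ((Primrec.fst.comp hb).comp Primrec.fst) Primrec.snd).to₂
        (Primrec.snd.comp hb)
    have hcg : Primrec fun q : (((ℕ × ℕ) × ℕ) × ℕ) × ℕ =>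
        countStrings (g q.1.2.unpair.1 q.2.unpair.1) q.2.unpair.2 :=
      primrec_countStrings_comp hg (Primrec.fst.comp ha) (Primrec.fst.comp hb)
        (Primrec.snd.comp hb)
    have h1 := (Primrec.nat_le.comp (Primrec.snd.comp ha) (Primrec.fst.comp hb)).decide
    have h2 := (Primrec.nat_le.comp
      (Primrec.nat_mul.comp (Primrec.snd.comp (Primrec.fst.comp hx)) hp)
      (Primrec.nat_mul.comp hk hcd)).decide
    have h3 := (Primrec.nat_le.comp
      (Primrec.nat_mul.comp (Primrec.succ.comp (Primrec.snd.comp hx)) hp)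
      (Primrec.nat_mul.comp hk hcg)).decide
    exact (Primrec.or.comp (Primrec.not.comp h1)
      (Primrec.or.comp (Primrec.not.comp h2) h3)).to_comp
  have hN := computableIn_zeroDoubleJump hR₁
  have hS := computableIn_zeroDoubleJump hR₂
  have hp : ∀ k, ∃ p, decide (∃ m, ∀ L, R₁ (k, p) m L = true) = true := fun k => by
    refine ⟨2 ^ k, decide_eq_true ⟨0, fun L => ?_⟩⟩
    simp only [R₁, Bool.not_eq_true', decide_eq_false_iff_not, not_le]
    calc 2 ^ k * countStrings (d 0) L ≤ 2 ^ k * 2 ^ L :=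
          Nat.mul_le_mul_left _ (countStrings_le _ _)
      _ < (2 ^ k + 1) * 2 ^ L := Nat.mul_lt_mul_of_pos_right (Nat.lt_succ_self _) (by positivity)
  -- By minimality, every `U m` has a stage of measure at least `P k / 2 ^ k`, so the guard in `R₂`
  -- is met for every `m`. On the other hand all late `U m` have measure at most `(P k + 1) / 2 ^
  -- k`, so a stage meeting the guard misses at most `2⁻ᵏ` of them.
  let P : ℕ → ℕ := fun k => Nat.find (hp k)
  have hP : ComputableIn (setOracle zeroDoubleJump) P := ComputableIn.find (P := fun k p =>
    decide (∃ m, ∀ L, R₁ (k, p) m L = true)) hN hp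
  have hP1 : ∀ k, ∃ m, ∀ L, R₁ (k, P k) m L = true := fun k => of_decide_eq_true (Nat.find_spec (hp k))
  have hP2 : ∀ k m, ∃ L, P k * 2 ^ L ≤ 2 ^ k * countStrings (d m) L := fun k m => by
    rcases hPk : P k with - | p
    · exact ⟨0, by simp⟩
    · have : p < Nat.find (hp k) := by change p < P k; omega
      have := Nat.find_min (hp k) this
      simp only [decide_eq_true_eq, not_exists, not_forall] at this
      obtain ⟨L, hL⟩ := this m
      exact ⟨L, by simpa [R₁] using hL⟩
  have hSsound : ∀ k j, (∃ a, ∀ b, R₂ ((k, P k), j) a b = true) → ((j + 1 : ℕ) : ℝ) / 2 ^ k ≤ α := by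
    rintro k j ⟨a, ha⟩
    refine sound a.unpair.1 a.unpair.2 _ fun m hm => ?_
    obtain ⟨L, hL⟩ := hP2 k m
    refine ⟨L, ?_⟩
    have := ha (Nat.pair m L)
    simp only [R₂, Nat.unpair_pair, decide_eq_true hm, hL, decide_true, Bool.not_true,
      Bool.false_or, decide_eq_true_eq] at this
    have h' : ((j + 1 : ℕ) : ℝ) * 2 ^ L ≤ 2 ^ k * countStrings (g a.unpair.1 m) L := by
      exact_mod_cast this
    rw [div_mul_eq_mul_div, div_le_iff₀ (by positivity)]
    linarith
  have hj : ∀ k, ∃ j, (!decide (∃ a, ∀ b, R₂ ((k, P k), j) a b = true)) = true := fun k => by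
    obtain ⟨j, hj⟩ := exists_nat_gt (α * 2 ^ k)
    refine ⟨j, ?_⟩
    simp only [Bool.not_eq_true', decide_eq_false_iff_not]
    intro h
    have := hSsound k j h
    rw [div_le_iff₀ (by positivity)] at this
    push_cast at this
    linarith
  -- The least `j` at which the `Σ⁰₂` condition fails: success just before it bounds `α` from below
  -- by `sound`, and failure at it bounds `α` from above by `complete`.
  let J : ℕ → ℕ := fun k => Nat.find (hj k)
  have hJ : ComputableIn (setOracle zeroDoubleJump) J := ComputableIn.find (P := fun k j =>
    !decide (∃ a, ∀ b, R₂ ((k, P k), j) a b = true))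
    (Primrec.not.computableIn.comp (hS.comp ((ComputableIn.fst.pair
      (hP.comp ComputableIn.fst)).pair ComputableIn.snd))) hj
  have hJ1 : ∀ k, (J k : ℝ) / 2 ^ k ≤ α := fun k => by
    rcases hJk : J k with - | j
    · simpa using h0
    · have : j < Nat.find (hj k) := by change j < J k; omega
      exact hSsound k j (by simpa using Nat.find_min (hj k) this)
  have hJ2 : ∀ k, α ≤ (J k + 3 : ℝ) / 2 ^ k := fun k => by
    by_contra! hlt
    have hne : ¬ ∃ a, ∀ b, R₂ ((k, P k), J k) a b = true := by
      have : (!decide (∃ a, ∀ b, R₂ ((k, P k), J k) a b = true)) = true := Nat.find_spec (hj k)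
      simpa only [Bool.not_eq_true', decide_eq_false_iff_not] using this
    obtain ⟨m₁, hm₁⟩ := hP1 k
    -- The 3 in the upper bound is the 1 in `j + 1` plus the loss `2 * ε` with `ε = 2⁻ᵏ`.
    obtain ⟨c, hc⟩ := complete ((J k + 1 : ℝ) / 2 ^ k) (1 / 2 ^ k) (by positivity) (by
      refine lt_of_eq_of_lt ?_ hlt
      ring)
    refine hne ⟨Nat.pair c m₁, fun b => ?_⟩
    simp only [R₂, Nat.unpair_pair, Bool.or_eq_true, Bool.not_eq_true', decide_eq_false_iff_not,
      decide_eq_true_eq]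
    by_cases hb : m₁ ≤ b.unpair.1
    · by_cases hb' : P k * 2 ^ b.unpair.2 ≤ 2 ^ k * countStrings (d b.unpair.1) b.unpair.2
      · refine Or.inr (Or.inr ?_)
        have hU : coinMeasure.real {X | ∃ L, d b.unpair.1 (X.take L) = true} ≤
            (P k + 1 : ℝ) / 2 ^ k := by
          have hsub : {X : BinSeq | ∃ L, d b.unpair.1 (X.take L) = true} ⊆
              {X | ∃ L, d m₁ (X.take L) = true} := fun X ⟨L, hL⟩ => ⟨L, hanti hb hL⟩
          refine (measureReal_mono hsub).trans
            (coinMeasure_real_exists_take_le (p := d m₁) (fun h => hmono h) fun L => ?_)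
          have := hm₁ L
          simp only [R₁, Bool.not_eq_true', decide_eq_false_iff_not, not_le] at this
          have h' : (2 : ℝ) ^ k * countStrings (d m₁) L < (P k + 1) * 2 ^ L := by
            exact_mod_cast this
          rw [div_mul_eq_mul_div, le_div_iff₀ (by positivity)]
          linarith
        have hlow : (P k : ℝ) / 2 ^ k ≤
            countStrings (d b.unpair.1) b.unpair.2 / 2 ^ b.unpair.2 := by
          rw [div_le_div_iff₀ (by positivity) (by positivity), mul_comm (countStrings _ _ : ℝ)]
          exact_mod_cast hb'
        have := hc b.unpair.1 b.unpair.2 (by rw [add_div] at hU; linarith)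
        rw [div_mul_eq_mul_div, div_le_iff₀ (by positivity)] at this
        have h' : ((J k : ℝ) + 1) * 2 ^ b.unpair.2 ≤
            2 ^ k * countStrings (g c b.unpair.1) b.unpair.2 := by linarith
        exact_mod_cast h'
      · exact Or.inr (Or.inl hb')
    · exact Or.inl hb
  -- With `j = J (n + 2)`, both `α` and the quotient by `2 ^ n` of `j / 4` rounded up lie between `j
  -- / 2 ^ (n + 2)` and `(j + 3) / 2 ^ (n + 2)`, an interval shorter than `2⁻ⁿ`.
  refine ⟨fun n => (((J (n + 2) + 3) / 4 : ℕ) : ℤ), ?_, fun n => ?_⟩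
  · have h4 : Primrec fun j : ℕ => (j + 3) / 4 :=
      Primrec.nat_div.comp (Primrec.nat_add.comp Primrec.id (Primrec.const 3)) (Primrec.const 4)
    exact primrec_int_ofNat.computableIn.comp (h4.computableIn.comp (hJ.comp
      (Primrec.nat_add.comp Primrec.id (Primrec.const 2)).computableIn))
  · have e1 := hJ1 (n + 2)
    have e2 := hJ2 (n + 2)
    set j := J (n + 2)
    set q := (j + 3) / 4 with hq
    have b1 : 4 * q ≤ j + 3 := by omega
    have b2 : j + 3 ≤ 4 * q + 3 := by omega
    have c1 : (4 * q : ℝ) ≤ j + 3 := by exact_mod_cast b1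
    have c2 : (j + 3 : ℝ) ≤ 4 * q + 3 := by exact_mod_cast b2
    have hpos : (0 : ℝ) < 2 ^ n := by positivity
    rw [pow_add, div_le_iff₀ (by positivity)] at e1
    rw [pow_add, le_div_iff₀ (by positivity)] at e2
    rw [Int.cast_natCast, abs_sub_le_iff]
    constructor
    · rw [sub_le_iff_le_add, ← add_div, le_div_iff₀ hpos]
      nlinarith
    · rw [sub_le_iff_le_add, div_le_iff₀ hpos, add_mul, one_div, inv_mul_cancel₀ hpos.ne']
      nlinarith

end Criterion

/-! ### Staged machines -/

section Staged

open MeasureTheory Filter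

/-- A decidable approximation to an oracle machine: `ev σ n` is the value computed from the finite
oracle `σ` within `σ.length` steps, if there is one. -/
structure StagedMachine where
  ev : List Bool → ℕ → Option ℕ
  primrec : Primrec₂ ev
  mono : ∀ {σ τ : List Bool} {n v : ℕ}, σ <+: τ → ev σ n = some v → ev τ n = some v

namespace StagedMachine

variable (S : StagedMachine)

def Computes (X : BinSeq) (f : ℕ → ℕ) : Prop := ∀ n, ∃ k, S.ev (X.take k) n = some (f n)

def cofiniteEvent : Set BinSeq :=
  {X | ∃ A : Set ℕ, Aᶜ.Finite ∧ S.Computes X fun n => (charSeq A n).toNat}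

def computableEvent : Set BinSeq := {X | ∃ f : ℕ → ℕ, Computable f ∧ S.Computes X f}

variable {S}

theorem ev_take_mono {X : BinSeq} {k l n v : ℕ} (h : k ≤ l) (hv : S.ev (X.take k) n = some v) :
    S.ev (X.take l) n = some v :=
  S.mono (X.take_prefix h) hv

theorem ev_take_unique {X : BinSeq} {k l n v w : ℕ} (hv : S.ev (X.take k) n = some v)
    (hw : S.ev (X.take l) n = some w) : v = w := by
  have h1 := ev_take_mono (le_max_left k l) hv
  have h2 := ev_take_mono (le_max_right k l) hw
  exact Option.some_injective _ (h1.symm.trans h2)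

theorem Computes.eventually {X : BinSeq} {f : ℕ → ℕ} (h : S.Computes X f) (m : ℕ) :
    ∀ᶠ L in atTop, ∀ i < m, S.ev (X.take L) i = some (f i) := by
  have := (eventually_all_finset (l := atTop) (Finset.range m)
    (p := fun i L => S.ev (X.take L) i = some (f i))).2 fun i _ => by
      obtain ⟨k, hk⟩ := h i
      exact eventually_atTop.2 ⟨k, fun l hl => ev_take_mono hl hk⟩
  simpa using this

theorem measurableSet_computes (f : ℕ → ℕ) : MeasurableSet {X | S.Computes X f} := by
  have : {X | S.Computes X f} = ⋂ n, {X | ∃ k, S.ev (X.take k) n = some (f n)} := by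
    ext X; simp [Computes]
  rw [this]
  exact MeasurableSet.iInter fun n => measurableSet_exists_take fun _ σ => S.ev σ n = some (f n)

variable (S)

theorem primrec_all_range (p : Option ℕ → Bool) (hp : Primrec p) :
    Primrec₂ fun (m : ℕ) (σ : List Bool) => (List.range m).all fun i => p (S.ev σ i) := by
  refine primrec_all (Primrec.list_range.comp Primrec.fst) ?_
  exact hp.comp (S.primrec.comp (Primrec.snd.comp Primrec.fst) Primrec.snd)

/-! #### Cofinite outputs -/

/-- The first `m` values computed from `σ` are defined and binary. -/
def bitsDefined (m : ℕ) (σ : List Bool) : Bool :=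
  decide (m ≤ σ.length) && (List.range m).all fun i => (S.ev σ i).any fun v => decide (v ≤ 1)

/-- No value different from `1` is computed from `σ` for an argument `n ≥ a`. -/
def onesFrom (a : ℕ) (σ : List Bool) : Bool :=
  (List.range σ.length).all fun n => decide (n < a) || (S.ev σ n).all fun v => decide (v = 1)

theorem primrec_option_elim {α : Type*} [Primcodable α] {p : α → Bool} (hp : Primrec p) (b : Bool) :
    Primrec fun o : Option α => o.elim b p :=
  (Primrec.option_casesOn Primrec.id (Primrec.const b) (hp.comp Primrec.snd).to₂).of_eq fun o => by
    cases o <;> rfl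

theorem primrec_bitsDefined : Primrec₂ S.bitsDefined := by
  have h1 : Primrec fun v : ℕ => decide (v ≤ 1) :=
    (Primrec.nat_le.comp Primrec.id (Primrec.const 1)).decide
  exact Primrec.and.comp
    (Primrec.nat_le.comp Primrec.fst (Primrec.list_length.comp Primrec.snd)).decide
    (S.primrec_all_range _ ((primrec_option_elim h1 false).of_eq fun o => by cases o <;> rfl))

theorem primrec_onesFrom : Primrec₂ S.onesFrom := by
  have h1 : Primrec fun v : ℕ => decide (v = 1) :=
    (Primrec.eq.comp Primrec.id (Primrec.const 1)).decide
  have h2 : Primrec fun o : Option ℕ => o.all fun v => decide (v = 1) :=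
    (primrec_option_elim h1 true).of_eq fun o => by cases o <;> rfl
  refine primrec_all (f := fun q : ℕ × List Bool => List.range q.2.length)
    (Primrec.list_range.comp (Primrec.list_length.comp Primrec.snd)) ?_
  exact Primrec.or.comp
    (Primrec.nat_lt.comp Primrec.snd (Primrec.fst.comp Primrec.fst)).decide
    (h2.comp (S.primrec.comp (Primrec.snd.comp Primrec.fst) Primrec.snd))

variable {S}

theorem bitsDefined_iff {m : ℕ} {σ : List Bool} : S.bitsDefined m σ = true ↔
    m ≤ σ.length ∧ ∀ i < m, ∃ v, S.ev σ i = some v ∧ v ≤ 1 := by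
  simp [bitsDefined, Option.any_eq_true]

theorem onesFrom_iff {a : ℕ} {σ : List Bool} : S.onesFrom a σ = true ↔
    ∀ n < σ.length, a ≤ n → ∀ v, S.ev σ n = some v → v = 1 := by
  simp only [onesFrom, List.all_eq_true, List.mem_range, Bool.or_eq_true, decide_eq_true_eq,
    Option.all_eq_true]
  refine forall_congr' fun n => forall_congr' fun _ => ?_
  rw [← not_le, or_iff_not_imp_left, not_not]

theorem bitsDefined_anti {m m' : ℕ} {σ : List Bool} (h : m ≤ m')
    (hσ : S.bitsDefined m' σ = true) : S.bitsDefined m σ = true := by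
  rw [bitsDefined_iff] at hσ ⊢
  exact ⟨h.trans hσ.1, fun i hi => hσ.2 i (hi.trans_le h)⟩

theorem bitsDefined_mono {m : ℕ} {σ τ : List Bool} (h : σ <+: τ)
    (hσ : S.bitsDefined m σ = true) : S.bitsDefined m τ = true := by
  rw [bitsDefined_iff] at hσ ⊢
  refine ⟨hσ.1.trans h.length_le, fun i hi => ?_⟩
  obtain ⟨v, hv, hv'⟩ := hσ.2 i hi
  exact ⟨v, S.mono h hv, hv'⟩

theorem onesFrom_anti {a : ℕ} {σ τ : List Bool} (h : σ <+: τ)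
    (hτ : S.onesFrom a τ = true) : S.onesFrom a σ = true := by
  rw [onesFrom_iff] at hτ ⊢
  exact fun n hn ha v hv => hτ n (hn.trans_le h.length_le) ha v (S.mono h hv)

theorem onesFrom_mono {a a' : ℕ} {σ : List Bool} (h : a ≤ a')
    (hσ : S.onesFrom a σ = true) : S.onesFrom a' σ = true := by
  rw [onesFrom_iff] at hσ ⊢
  exact fun n hn ha => hσ n hn (h.trans ha)

/-- The `Π⁰₂` part says that all values exist and are bits. The `Σ⁰₂` part only forbids wrong values
beyond some place and tolerates undefined ones, which keeps its matrix decidable. -/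
theorem cofiniteEvent_eq : S.cofiniteEvent =
    {X | ∀ m, ∃ L, S.bitsDefined m (X.take L) = true} ∩
      {X | ∃ a, ∀ L, S.onesFrom a (X.take L) = true} := by
  ext X
  constructor
  · rintro ⟨A, hA, hX⟩
    refine ⟨fun m => ?_, ?_⟩
    · obtain ⟨L, hL, hm⟩ := ((hX.eventually m).and (eventually_ge_atTop m)).exists
      exact ⟨L, bitsDefined_iff.2 ⟨by simpa using hm, fun i hi => ⟨_, hL i hi, Bool.toNat_le _⟩⟩⟩
    · obtain ⟨a, ha⟩ := hA.bddAbove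
      refine ⟨a + 1, fun L => onesFrom_iff.2 fun n _ hn v hv => ?_⟩
      obtain ⟨k, hk⟩ := hX n
      rw [ev_take_unique hv hk]
      have : n ∈ A := by
        by_contra hnA
        have := ha hnA
        omega
      simp [charSeq, this]
  · rintro ⟨hP, a, ha⟩
    have hval : ∀ n, ∃ L v, S.ev (X.take L) n = some v ∧ v ≤ 1 := fun n => by
      obtain ⟨L, hL⟩ := hP (n + 1)
      obtain ⟨v, hv⟩ := (bitsDefined_iff.1 hL).2 n (Nat.lt_succ_self n)
      exact ⟨L, v, hv⟩
    refine ⟨{n | ∃ L, S.ev (X.take L) n = some 1}, ?_, fun n => ?_⟩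
    · refine (Set.finite_lt_nat a).subset fun n hn => ?_
      by_contra han
      obtain ⟨L, v, hv, _⟩ := hval n
      -- `onesFrom` inspects only arguments below the length of the string, so the string is
      -- extended past `n`.
      have hv' := ev_take_mono (le_max_left L (n + 1)) hv
      have := onesFrom_iff.1 (ha (max L (n + 1))) n (by simp) (not_lt.1 han) v hv'
      subst this
      exact hn ⟨L, hv⟩
    · obtain ⟨L, v, hv, hv1⟩ := hval n
      refine ⟨L, hv.trans (congrArg some ?_)⟩
      dsimp only
      by_cases hn : ∃ L, S.ev (X.take L) n = some 1
      · have h1 : charSeq {n | ∃ L, S.ev (X.take L) n = some 1} n = true := by simpa [charSeq] using hn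
        obtain ⟨L', hL'⟩ := hn
        rw [h1, ev_take_unique hv hL']
        rfl
      · have h1 : charSeq {n | ∃ L, S.ev (X.take L) n = some 1} n = false := by
          simpa [charSeq] using hn
        rw [h1]
        have : v ≠ 1 := fun h => hn ⟨L, h ▸ hv⟩
        change v = 0
        omega

theorem cofiniteEvent_arithmetical :
    ∃ P T : Set BinSeq, IsPi02Class P ∧ IsSigma02Class T ∧ S.cofiniteEvent = P ∩ T := by
  refine ⟨_, _, ?_, ?_, cofiniteEvent_eq⟩
  · refine ⟨fun p => (!S.bitsDefined p.1 p.2) = true, ?_, ?_⟩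
    · exact ((Primrec.eq.comp (Primrec.not.comp S.primrec_bitsDefined)
        (Primrec.const true)).computablePred)
    · ext X; simp
  · exact ⟨fun p => S.onesFrom p.1 p.2 = true,
      (Primrec.eq.comp S.primrec_onesFrom (Primrec.const true)).computablePred, rfl⟩

end StagedMachine

/-! ### Limits of monotone sequences of events -/

theorem mul_le_countStrings {p : List Bool → Bool} {L : ℕ} {r : ℝ} :
    r * 2 ^ L ≤ countStrings p L ↔ r ≤ coinMeasure.real {X | p (X.take L) = true} := by
  rw [countStrings_eq]
  exact mul_le_mul_iff_left₀ (by positivity)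

theorem le_measureReal_iInter {B : ℕ → Set BinSeq} (hB : Antitone B)
    (hm : ∀ m, MeasurableSet (B m)) {r : ℝ} {m₀ : ℕ}
    (h : ∀ m ≥ m₀, r ≤ coinMeasure.real (B m)) : r ≤ coinMeasure.real (⋂ m, B m) := by
  have ht := tendsto_measure_iInter_atTop (μ := coinMeasure)
    (fun m => (hm m).nullMeasurableSet) hB ⟨0, measure_ne_top _ _⟩
  exact ge_of_tendsto ((ENNReal.tendsto_toReal (measure_ne_top _ _)).comp ht)
    (eventually_atTop.2 ⟨m₀, h⟩)

theorem exists_lt_measureReal_of_iUnion {B : ℕ → Set BinSeq} (hB : Monotone B) {r : ℝ}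
    (h : r < coinMeasure.real (⋃ m, B m)) : ∃ m, r < coinMeasure.real (B m) := by
  have ht := tendsto_measure_iUnion_atTop (μ := coinMeasure) hB
  exact (((ENNReal.tendsto_toReal (measure_ne_top _ _)).comp ht).eventually
    (lt_mem_nhds h)).exists

namespace StagedMachine

variable {S : StagedMachine}

/-- Here `c` bounds the last zero of the output. For completeness, the event is the increasing union
over `c` of the classes with that bound. Outside the stage-`L` test such a class lies in the part of
`U m` not yet visible, of measure at most `ε`. -/
theorem isComputableReal_cofiniteEvent :
    IsComputableRealIn zeroDoubleJump (coinMeasure.real S.cofiniteEvent) := by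
  have hms : ∀ m, MeasurableSet {X : BinSeq | ∃ L, S.bitsDefined m (X.take L) = true} := fun m =>
    measurableSet_exists_take fun _ σ => S.bitsDefined m σ = true
  refine isComputableRealIn_of_approx measureReal_nonneg (d := S.bitsDefined)
    (g := fun c m σ => S.bitsDefined m σ && S.onesFrom c σ) S.primrec_bitsDefined ?_
    bitsDefined_anti bitsDefined_mono ?_ ?_
  · exact Primrec.and.comp
      (S.primrec_bitsDefined.comp (Primrec.snd.comp Primrec.fst) Primrec.snd)
      (S.primrec_onesFrom.comp (Primrec.fst.comp Primrec.fst) Primrec.snd)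
  · intro c m₀ r h
    -- Testing `onesFrom` at depth `m` makes the classes decrease, and their intersection imposes
    -- the condition at every depth.
    let B : ℕ → Set BinSeq := fun m =>
      {X | ∃ L, S.bitsDefined m (X.take L) = true} ∩ {X | S.onesFrom c (X.take m) = true}
    have hB : Antitone B := fun m m' hmm X hX =>
      ⟨hX.1.imp fun L => bitsDefined_anti hmm, onesFrom_anti (X.take_prefix hmm) hX.2⟩
    refine (le_measureReal_iInter (m₀ := m₀) hB (fun m => (hms m).inter
      (measurableSet_take m fun σ => S.onesFrom c σ = true)) fun m hm => ?_).trans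
      (measureReal_mono ?_)
    · obtain ⟨L, hL⟩ := h m hm
      refine (mul_le_countStrings.1 hL).trans (measureReal_mono fun X hX => ?_)
      simp only [Bool.and_eq_true, Set.mem_ofPred_eq] at hX
      -- This is what the length clause in `bitsDefined` is for: the condition on ones, known at
      -- depth `L`, passes down to depth `m`.
      have : m ≤ L := by simpa using (bitsDefined_iff.1 hX.1).1
      exact ⟨⟨L, hX.1⟩, onesFrom_anti (X.take_prefix this) hX.2⟩
    · intro X hX
      rw [Set.mem_iInter] at hX
      rw [cofiniteEvent_eq]
      exact ⟨fun m => (hX m).1, c, fun m => (hX m).2⟩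
  · intro r ε hε hr
    let B : ℕ → Set BinSeq := fun c => {X | ∀ m, ∃ L, S.bitsDefined m (X.take L) = true} ∩
      {X | ∀ L, S.onesFrom c (X.take L) = true}
    have hB : Monotone B := fun c c' hcc X hX => ⟨hX.1, fun L => onesFrom_mono hcc (hX.2 L)⟩
    have hU : S.cofiniteEvent = ⋃ c, B c := by
      rw [cofiniteEvent_eq]
      ext X
      simp [B]
    rw [hU] at hr
    obtain ⟨c, hc⟩ := exists_lt_measureReal_of_iUnion hB hr
    refine ⟨c, fun m L hL => mul_le_countStrings.2 ?_⟩
    rw [← coinMeasure_real_take] at hL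
    have hV : {X : BinSeq | S.bitsDefined m (X.take L) = true} ⊆
        {X | ∃ L, S.bitsDefined m (X.take L) = true} := fun X hX => ⟨L, hX⟩
    have hdiff := measureReal_sdiff (μ := coinMeasure) hV
      (measurableSet_take L fun σ => S.bitsDefined m σ = true)
    have hsub : B c ⊆ {X | (S.bitsDefined m (X.take L) && S.onesFrom c (X.take L)) = true} ∪
        ({X | ∃ L, S.bitsDefined m (X.take L) = true} \
          {X | S.bitsDefined m (X.take L) = true}) := by
      intro X hX
      by_cases hd : S.bitsDefined m (X.take L) = true
      · exact Or.inl (by simp [hd, hX.2 L])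
      · exact Or.inr ⟨hX.1 m, hd⟩
    have h1 := (measureReal_mono (μ := coinMeasure) hsub).trans (measureReal_union_le _ _)
    linarith

end StagedMachine

end Staged

/-! ### Computable outputs -/

section ComputableOutput

open MeasureTheory Filter

theorem countable_computable : {f : ℕ → ℕ | Computable f}.Countable := by
  classical
  refine (Set.countable_range fun (c : Nat.Partrec.Code) (n : ℕ) =>
    if h : (c.eval n).Dom then (c.eval n).get h else 0).mono fun f hf => ?_
  obtain ⟨c, hc⟩ := Nat.Partrec.Code.exists_code.1 (Partrec.nat_iff.1 hf.partrec)
  refine ⟨c, funext fun n => ?_⟩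
  simp [hc]

/-- If `V` occupies at most half of each of the pairwise disjoint sets `E i`, `i ∈ s`,
then the part of `V` inside these sets is at most as large as the part of `⋃ i, E i` outside `V`. -/
theorem measure_biUnion_inter_le {Ω ι : Type*} [MeasurableSpace Ω] [Countable ι] {μ : Measure Ω}
    {s : Set ι} {E : ι → Set Ω} {V : Set Ω} (hd : Pairwise (Function.onFun Disjoint E))
    (hE : ∀ i, MeasurableSet (E i)) (hV : MeasurableSet V)
    (h : ∀ i ∈ s, μ (V ∩ E i) ≤ μ (E i \ V)) :
    μ (⋃ i ∈ s, V ∩ E i) ≤ μ ((⋃ i, E i) \ V) := by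
  calc μ (⋃ i ∈ s, V ∩ E i) ≤ ∑' i : s, μ (V ∩ E i) := measure_biUnion_le μ (Set.to_countable s) _
    _ ≤ ∑' i : s, μ (E i \ V) := ENNReal.tsum_le_tsum fun i => h i i.2
    _ ≤ ∑' i, μ (E i \ V) := ENNReal.tsum_comp_le_tsum_of_injective Subtype.val_injective _
    _ = μ ((⋃ i, E i) \ V) := by
      rw [Set.iUnion_sdiff, measure_iUnion]
      · exact fun i j hij => (hd hij).mono Set.sdiff_subset Set.sdiff_subset
      · exact fun i => (hE i).diff hV

namespace StagedMachine

variable (S : StagedMachine)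

theorem measurableSet_computableEvent : MeasurableSet S.computableEvent := by
  have : S.computableEvent = ⋃ f ∈ {f : ℕ → ℕ | Computable f}, {X | S.Computes X f} := by
    ext X; simp [computableEvent]
  rw [this]
  exact MeasurableSet.biUnion countable_computable fun f _ => measurableSet_computes f

/-- The oracles from which the first `m` values of `f` are computed. -/
def segmentEvent (m : ℕ) (f : ℕ → ℕ) : Set BinSeq :=
  {X | ∃ L, ∀ i < m, S.ev (X.take L) i = some (f i)}

variable {S}

theorem measurableSet_segmentEvent (m : ℕ) (f : ℕ → ℕ) : MeasurableSet (S.segmentEvent m f) :=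
  measurableSet_exists_take fun _ σ => ∀ i < m, S.ev σ i = some (f i)

theorem segmentEvent_anti (f : ℕ → ℕ) : Antitone fun m => S.segmentEvent m f :=
  fun _ _ h _ ⟨L, hL⟩ => ⟨L, fun i hi => hL i (hi.trans_le h)⟩

theorem segmentEvent_congr {m : ℕ} {f g : ℕ → ℕ} (h : ∀ i < m, f i = g i) :
    S.segmentEvent m f = S.segmentEvent m g := by
  ext X
  refine exists_congr fun L => forall₂_congr fun i hi => ?_
  rw [h i hi]

theorem setOf_computes_eq (f : ℕ → ℕ) : {X | S.Computes X f} = ⋂ m, S.segmentEvent m f := by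
  ext X
  rw [Set.mem_iInter]
  constructor
  · exact fun h m => (Computes.eventually h m).exists
  · intro h n
    obtain ⟨L, hL⟩ := h (n + 1)
    exact ⟨L, hL n (Nat.lt_succ_self n)⟩

theorem tendsto_segmentEvent (f : ℕ → ℕ) :
    Tendsto (fun m => coinMeasure.real (S.segmentEvent m f)) atTop
      (nhds (coinMeasure.real {X | S.Computes X f})) := by
  rw [setOf_computes_eq]
  exact (ENNReal.tendsto_toReal (measure_ne_top _ _)).comp (tendsto_measure_iInter_atTop
    (fun m => (measurableSet_segmentEvent m f).nullMeasurableSet) (segmentEvent_anti f)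
    ⟨0, measure_ne_top _ _⟩)

theorem segmentEvent_unique {X : BinSeq} {m : ℕ} {f g : ℕ → ℕ} (hf : X ∈ S.segmentEvent m f)
    (hg : X ∈ S.segmentEvent m g) {i : ℕ} (hi : i < m) : f i = g i := by
  obtain ⟨L, hL⟩ := hf
  obtain ⟨L', hL'⟩ := hg
  exact ev_take_unique (hL i hi) (hL' i hi)

/-- A function which is computed with positive probability is the majority vote over a suitable
clopen class of oracles. -/
theorem exists_majority {f : ℕ → ℕ} (hf : 0 < coinMeasure.real {X | S.Computes X f}) :
    ∃ (L : ℕ) (D : List (List Bool)), (∀ σ ∈ D, σ.length = L) ∧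
      coinMeasure.real {X : BinSeq | X.take L ∈ D} <
        2 * coinMeasure.real ({X | S.Computes X f} ∩ {X | X.take L ∈ D}) := by
  -- A density argument: for large `m`, more than half of the oracles computing the first `m` values
  -- of `f` compute all of `f`. Replacing that open class by a late clopen part preserves the
  -- majority.
  obtain ⟨m, hm⟩ := ((tendsto_segmentEvent (S := S) f).eventually
    (gt_mem_nhds (show _ < 2 * coinMeasure.real {X | S.Computes X f} by linarith))).exists
  let V : ℕ → Set BinSeq := fun L => {X | ∀ i < m, S.ev (X.take L) i = some (f i)}
  have hV : Monotone V := monotone_setOf_take (p := fun σ => ∀ i < m, S.ev σ i = some (f i))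
    fun h hσ i hi => S.mono h (hσ i hi)
  have hU : (⋃ L, {X | S.Computes X f} ∩ V L) = {X | S.Computes X f} := by
    rw [← Set.inter_iUnion]
    refine Set.inter_eq_left.2 fun X hX => ?_
    obtain ⟨L, hL⟩ := (Computes.eventually hX m).exists
    exact Set.mem_iUnion.2 ⟨L, hL⟩
  obtain ⟨L, hL⟩ := exists_lt_measureReal_of_iUnion
    (B := fun L => {X | S.Computes X f} ∩ V L)
    (fun _ _ h => Set.inter_subset_inter_right _ (hV h))
    (r := coinMeasure.real (S.segmentEvent m f) / 2) (by rw [hU]; linarith)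
  let D := (binStrings L).filter fun σ => decide (∀ i < m, S.ev σ i = some (f i))
  have hD : V L = {X | X.take L ∈ D} := by
    ext X
    simp [V, D, mem_binStrings]
  refine ⟨L, D, fun σ hσ => mem_binStrings.1 (List.mem_filter.1 hσ).1, ?_⟩
  rw [← hD]
  have : coinMeasure.real (V L) ≤ coinMeasure.real (S.segmentEvent m f) :=
    measureReal_mono fun X hX => ⟨L, hX⟩
  linarith

/-- A function which is computed from an oracle with positive probability is computable. -/
theorem computable_of_measure_pos {f : ℕ → ℕ} (hf : 0 < coinMeasure.real {X | S.Computes X f}) :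
    Computable f := by
  obtain ⟨L, D, hDL, hD⟩ := exists_majority hf
  set V : Set BinSeq := {X | X.take L ∈ D} with hVdef
  let w : List Bool → Bool := fun τ => decide (τ.take L ∈ D)
  have hwV : ∀ {k : ℕ}, L ≤ k → {X : BinSeq | w (X.take k) = true} = V := fun hk => by
    ext X
    simp [w, X.take_take hk, hVdef]
  -- `N` codes a candidate value and a length; the value is accepted if more than half of the
  -- strings of that length in the clopen class produce it.
  let acc : ℕ → ℕ → Option ℕ := fun n N =>
    if countStrings w N.unpair.2 <
      2 * countStrings (fun τ => w τ && decide (S.ev τ n = some N.unpair.1)) N.unpair.2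
    then some N.unpair.1 else none
  have hacc : Computable₂ acc := by
    have hw : Primrec w := by
      have h1 := PrimrecRel.exists_mem_list (Primrec.eq (α := List Bool))
      have h2 := (h1.comp (Primrec.const D) (Primrec.list_take.comp (Primrec.const L)
        Primrec.id)).decide
      exact h2.of_eq fun τ => by simp [w]
    have hN : Primrec fun q : ℕ × ℕ => q.2.unpair := Primrec.unpair.comp Primrec.snd
    have h1 : Primrec fun q : ℕ × ℕ => countStrings w q.2.unpair.2 :=
      primrec_countStrings (p := fun (_ : ℕ × ℕ) τ => w τ) (hw.comp Primrec.snd)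
        (Primrec.snd.comp hN)
    have h2 : Primrec fun q : ℕ × ℕ =>
        countStrings (fun τ => w τ && decide (S.ev τ q.1 = some q.2.unpair.1)) q.2.unpair.2 := by
      refine primrec_countStrings
        (p := fun (q : ℕ × ℕ) τ => w τ && decide (S.ev τ q.1 = some q.2.unpair.1)) ?_
        (Primrec.snd.comp hN)
      exact Primrec.and.comp (hw.comp Primrec.snd) (Primrec.eq.comp
        (S.primrec.comp Primrec.snd (Primrec.fst.comp Primrec.fst))
        (Primrec.option_some.comp ((Primrec.fst.comp hN).comp Primrec.fst))).decide
    exact (Primrec.ite (Primrec.nat_lt.comp h1 (Primrec.nat_mul.comp (Primrec.const 2) h2))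
      (Primrec.option_some.comp (Primrec.fst.comp hN)) (Primrec.const none)).to_comp
  have hsound : ∀ n N v, v ∈ acc n N → v = f n := by
    intro n N v hv
    simp only [acc, Option.mem_def] at hv
    split_ifs at hv with hlt
    obtain rfl := Option.some_injective _ hv
    set k := N.unpair.2
    have hk : L ≤ k := by
      by_contra hk
      -- Strings shorter than `L` have no prefix in `D`, so no vote can succeed at such a length.
      have h0 : countStrings (fun τ => w τ && decide (S.ev τ n = some N.unpair.1)) k = 0 := by
        rw [countStrings, List.length_eq_zero_iff, List.filter_eq_nil_iff]
        intro τ hτ hτ'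
        simp only [w, Bool.and_eq_true, decide_eq_true_eq] at hτ'
        have h1 := hDL _ hτ'.1
        have h2 := mem_binStrings.1 hτ
        simp only [List.length_take] at h1
        omega
      omega
    have hlt' : (countStrings w k : ℝ) <
        2 * countStrings (fun τ => w τ && decide (S.ev τ n = some N.unpair.1)) k := by
      exact_mod_cast hlt
    rw [countStrings_eq, countStrings_eq, ← mul_assoc, hwV hk] at hlt'
    have hlt2 := lt_of_mul_lt_mul_right hlt' (by positivity)
    -- Two majorities of `V` intersect: some oracle both computes `f` and votes for the accepted
    -- value.
    obtain ⟨X, hX1, hX2⟩ := nonempty_inter_of_measureReal_lt_add (μ := coinMeasure)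
      (s := {X | S.Computes X f} ∩ V)
      (t := {X : BinSeq | (w (X.take k) && decide (S.ev (X.take k) n = some N.unpair.1)) = true})
      (u := V) (measurableSet_take k fun τ =>
        (w τ && decide (S.ev τ n = some N.unpair.1)) = true) Set.inter_subset_right
      (fun X hX => by
        rw [← hwV hk]
        simp only [Set.mem_ofPred_eq, Bool.and_eq_true] at hX
        exact hX.1) (by linarith)
    obtain ⟨l, hl⟩ := hX1.1 n
    simp only [Set.mem_ofPred_eq, Bool.and_eq_true, decide_eq_true_eq] at hX2
    exact ev_take_unique hX2.2 hl
  have hcomplete : ∀ n, ∃ N, f n ∈ acc n N := by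
    intro n
    let B : ℕ → Set BinSeq := fun k => V ∩ {X | S.ev (X.take (L + k)) n = some (f n)}
    have hB : Monotone B := fun k k' h X hX =>
      ⟨hX.1, ev_take_mono (Nat.add_le_add_left h L) hX.2⟩
    have hU : {X | S.Computes X f} ∩ V ⊆ ⋃ k, B k := by
      rintro X ⟨hX, hXV⟩
      obtain ⟨k, hk⟩ := hX n
      exact Set.mem_iUnion.2 ⟨k, hXV, ev_take_mono (Nat.le_add_left k L) hk⟩
    obtain ⟨k, hk⟩ := exists_lt_measureReal_of_iUnion hB (r := coinMeasure.real V / 2) (by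
      have := measureReal_mono (μ := coinMeasure) hU
      linarith)
    refine ⟨Nat.pair (f n) (L + k), ?_⟩
    have hlt : countStrings w (L + k) <
        2 * countStrings (fun τ => w τ && decide (S.ev τ n = some (f n))) (L + k) := by
      have heq : {X : BinSeq | (w (X.take (L + k)) &&
          decide (S.ev (X.take (L + k)) n = some (f n))) = true} = B k := by
        ext X
        have := Set.ext_iff.1 (hwV (Nat.le_add_right L k)) X
        simp only [Set.mem_ofPred_eq] at this
        simp only [B, Set.mem_inter_iff, Set.mem_ofPred_eq, Bool.and_eq_true, decide_eq_true_eq, this]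
      have : (countStrings w (L + k) : ℝ) <
          2 * countStrings (fun τ => w τ && decide (S.ev τ n = some (f n))) (L + k) := by
        rw [countStrings_eq, countStrings_eq, ← mul_assoc, hwV (Nat.le_add_right L k), heq]
        exact mul_lt_mul_of_pos_right (by linarith) (by positivity)
      exact_mod_cast this
    simp [acc, hlt]
  refine (Partrec.rfindOpt hacc).of_eq_tot fun n => ?_
  obtain ⟨N, hN⟩ := hcomplete n
  have hdom : (Nat.rfindOpt (acc n)).Dom := Nat.rfindOpt_dom.2 ⟨N, _, hN⟩
  obtain ⟨N', hN'⟩ := Nat.rfindOpt_spec (Part.get_mem hdom)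
  rw [← hsound n N' _ hN']
  exact Part.get_mem hdom

/-! ### Heavy output segments and the measure of the computable outputs -/

variable (S)

def definedTo (m : ℕ) (σ : List Bool) : Bool := (List.range m).all fun i => (S.ev σ i).isSome

/-- The values computed from `σ` and `τ` coincide for arguments below `m`. -/
def agree (m : ℕ) (σ τ : List Bool) : Bool :=
  (List.range m).all fun i => decide (S.ev σ i = S.ev τ i)

/-- Among the strings of the length of `σ`, a proportion of at least `2⁻ᶜ` yields
the same first `m` values as `σ`. -/
def heavy (c m : ℕ) (σ : List Bool) : Bool :=
  S.definedTo m σ && decide (2 ^ σ.length ≤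
    2 ^ c * countStrings (fun τ => S.definedTo m τ && S.agree m σ τ) σ.length)

theorem primrec_definedTo : Primrec₂ S.definedTo :=
  S.primrec_all_range _ Primrec.option_isSome

theorem primrec_agree : Primrec fun q : (ℕ × List Bool) × List Bool => S.agree q.1.1 q.1.2 q.2 := by
  refine primrec_all (f := fun q : (ℕ × List Bool) × List Bool => List.range q.1.1)
    (Primrec.list_range.comp (Primrec.fst.comp Primrec.fst)) ?_
  exact (Primrec.eq.comp
    (S.primrec.comp (Primrec.snd.comp (Primrec.fst.comp Primrec.fst)) Primrec.snd)
    (S.primrec.comp (Primrec.snd.comp Primrec.fst) Primrec.snd)).decide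

theorem primrec_heavy : Primrec fun q : (ℕ × ℕ) × List Bool => S.heavy q.1.1 q.1.2 q.2 := by
  have hm : Primrec fun q : (ℕ × ℕ) × List Bool => q.1.2 := Primrec.snd.comp Primrec.fst
  have hl : Primrec fun q : (ℕ × ℕ) × List Bool => q.2.length :=
    Primrec.list_length.comp Primrec.snd
  have h1 : Primrec fun q : (ℕ × ℕ) × List Bool =>
      countStrings (fun τ => S.definedTo q.1.2 τ && S.agree q.1.2 q.2 τ) q.2.length := by
    refine primrec_countStrings
      (p := fun (q : (ℕ × ℕ) × List Bool) τ => S.definedTo q.1.2 τ && S.agree q.1.2 q.2 τ) ?_ hl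
    exact Primrec.and.comp (S.primrec_definedTo.comp (hm.comp Primrec.fst) Primrec.snd)
      (S.primrec_agree.comp (g := fun r : ((ℕ × ℕ) × List Bool) × List Bool =>
        ((r.1.1.2, r.1.2), r.2))
        (((hm.comp Primrec.fst).pair (Primrec.snd.comp Primrec.fst)).pair Primrec.snd))
  exact Primrec.and.comp (S.primrec_definedTo.comp hm Primrec.snd)
    (Primrec.nat_le.comp (primrec_nat_pow.comp (Primrec.const 2) hl)
      (Primrec.nat_mul.comp (primrec_nat_pow.comp (Primrec.const 2)
        (Primrec.fst.comp Primrec.fst)) h1)).decide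

variable {S}

theorem definedTo_iff {m : ℕ} {σ : List Bool} :
    S.definedTo m σ = true ↔ ∃ f : ℕ → ℕ, ∀ i < m, S.ev σ i = some (f i) := by
  simp only [definedTo, List.all_eq_true, List.mem_range]
  constructor
  · intro h
    refine ⟨fun i => (S.ev σ i).getD 0, fun i hi => ?_⟩
    obtain ⟨v, hv⟩ := Option.isSome_iff_exists.1 (h i hi)
    simp [hv]
  · rintro ⟨f, hf⟩ i hi
    simp [hf i hi]

theorem definedTo_anti {m m' : ℕ} {σ : List Bool} (h : m ≤ m')
    (hσ : S.definedTo m' σ = true) : S.definedTo m σ = true := by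
  rw [definedTo_iff] at hσ ⊢
  exact hσ.imp fun f hf i hi => hf i (hi.trans_le h)

theorem definedTo_mono {m : ℕ} {σ τ : List Bool} (h : σ <+: τ)
    (hσ : S.definedTo m σ = true) : S.definedTo m τ = true := by
  rw [definedTo_iff] at hσ ⊢
  exact hσ.imp fun f hf i hi => S.mono h (hf i hi)

theorem setOf_agree_eq {X : BinSeq} {m L : ℕ} {f : ℕ → ℕ} (hd : S.definedTo m (X.take L) = true)
    (hX : X ∈ S.segmentEvent m f) :
    {Y : BinSeq | (S.definedTo m (Y.take L) && S.agree m (X.take L) (Y.take L)) = true} =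
      {Y | S.definedTo m (Y.take L) = true} ∩ S.segmentEvent m f := by
  obtain ⟨g, hg⟩ := definedTo_iff.1 hd
  have hgf : ∀ i < m, S.ev (X.take L) i = some (f i) := fun i hi => by
    rw [hg i hi, segmentEvent_unique ⟨L, hg⟩ hX hi]
  ext Y
  simp only [agree, Set.mem_inter_iff, Set.mem_ofPred_eq, Bool.and_eq_true, List.all_eq_true,
    List.mem_range, decide_eq_true_eq]
  refine and_congr_right fun hY => ⟨fun h => ⟨L, fun i hi => (h i hi).symm.trans (hgf i hi)⟩, ?_⟩
  intro h i hi
  obtain ⟨g', hg'⟩ := definedTo_iff.1 hY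
  rw [hgf i hi, hg' i hi, segmentEvent_unique h ⟨L, hg'⟩ hi]

/-- At stage `L` only the part of the segment class that is already visible can be counted. It may
be smaller than the whole class, and this forces the change of threshold in the completeness
argument below. -/
theorem heavy_iff {X : BinSeq} {c m L : ℕ} {f : ℕ → ℕ} (hd : S.definedTo m (X.take L) = true)
    (hX : X ∈ S.segmentEvent m f) : S.heavy c m (X.take L) = true ↔ 1 / 2 ^ c ≤
      coinMeasure.real ({Y | S.definedTo m (Y.take L) = true} ∩ S.segmentEvent m f) := by
  rw [← setOf_agree_eq hd hX,
    ← mul_le_countStrings (p := fun τ => S.definedTo m τ && S.agree m (X.take L) τ), heavy, hd,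
    Bool.true_and, decide_eq_true_eq,
    BinSeq.length_take, one_div, inv_mul_le_iff₀ (by positivity)]
  exact_mod_cast Iff.rfl

/-- The class of oracles whose output is an atom of measure at least `2⁻ᶜ`. -/
def atomEvent (S : StagedMachine) (c : ℕ) : Set BinSeq :=
  {X | ∃ f, S.Computes X f ∧ 1 / 2 ^ c ≤ coinMeasure.real {Y | S.Computes Y f}}

theorem atomEvent_subset (c : ℕ) : S.atomEvent c ⊆ S.computableEvent := fun _ ⟨f, hf, hc⟩ =>
  ⟨f, computable_of_measure_pos (lt_of_lt_of_le (by positivity) hc), hf⟩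

theorem monotone_atomEvent : Monotone S.atomEvent := fun c c' h X ⟨f, hf, hc⟩ =>
  ⟨f, hf, le_trans (one_div_le_one_div_of_le (by positivity)
    (pow_le_pow_right₀ (by norm_num) h)) hc⟩

/-- A computable output that is not an atom has probability zero, and there are only countably many
computable functions. -/
theorem measure_computableEvent_le :
    coinMeasure.real S.computableEvent ≤ coinMeasure.real (⋃ c, S.atomEvent c) := by
  have hnull : coinMeasure (⋃ f ∈ {f : ℕ → ℕ | Computable f ∧
      coinMeasure {X | S.Computes X f} = 0}, {X | S.Computes X f}) = 0 :=
    (measure_biUnion_null_iff (countable_computable.mono fun f hf => hf.1)).2 fun f hf => hf.2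
  have hsub : S.computableEvent ⊆ (⋃ c, S.atomEvent c) ∪ ⋃ f ∈ {f : ℕ → ℕ | Computable f ∧
      coinMeasure {X | S.Computes X f} = 0}, {X | S.Computes X f} := by
    rintro X ⟨f, hf, hX⟩
    by_cases h0 : coinMeasure {X | S.Computes X f} = 0
    · exact Or.inr (Set.mem_biUnion (x := f) ⟨hf, h0⟩ hX)
    · have hpos : 0 < coinMeasure.real {X | S.Computes X f} :=
        ENNReal.toReal_pos h0 (measure_ne_top _ _)
      obtain ⟨c, hc⟩ := exists_pow_lt_of_lt_one hpos (show (1 / 2 : ℝ) < 1 by norm_num)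
      refine Or.inl (Set.mem_iUnion.2 ⟨c, f, hX, ?_⟩)
      rw [← one_div_pow]
      exact hc.le
  refine (measureReal_mono (μ := coinMeasure) hsub).trans ((measureReal_union_le _ _).trans ?_)
  rw [measureReal_def coinMeasure (⋃ f ∈ _, _), hnull]
  simp

/-- Soundness: if every initial segment of an output has mass at least `2⁻ᶜ`, so does the output, by
continuity. Completeness loses `ε` twice: once for oracles not yet visible at stage `L`, and once
for visible ones whose segment is heavy but mostly invisible. -/
theorem isComputableReal_computableEvent :
    IsComputableRealIn zeroDoubleJump (coinMeasure.real S.computableEvent) := by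
  refine isComputableRealIn_of_approx measureReal_nonneg (d := S.definedTo)
    (g := S.heavy) S.primrec_definedTo S.primrec_heavy definedTo_anti definedTo_mono ?_ ?_
  · intro c m₀ r h
    let B : ℕ → Set BinSeq := fun m =>
      {X | ∃ f, X ∈ S.segmentEvent m f ∧ 1 / 2 ^ c ≤ coinMeasure.real (S.segmentEvent m f)}
    have hB : Antitone B := fun m m' hmm X ⟨f, hX, hf⟩ => ⟨f, segmentEvent_anti f hmm hX,
      hf.trans (measureReal_mono (segmentEvent_anti f hmm))⟩
    have hBm : ∀ m, MeasurableSet (B m) := fun m => by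
      have : B m = {X | ∃ L, ∃ f : ℕ → ℕ, (∀ i < m, S.ev (X.take L) i = some (f i)) ∧
          1 / 2 ^ c ≤ coinMeasure.real (S.segmentEvent m f)} := by
        ext X
        constructor
        · rintro ⟨f, ⟨L, hL⟩, hf⟩
          exact ⟨L, f, hL, hf⟩
        · rintro ⟨L, f, hL, hf⟩
          exact ⟨f, ⟨L, hL⟩, hf⟩
      rw [this]
      exact measurableSet_exists_take fun _ σ => ∃ f : ℕ → ℕ, (∀ i < m, S.ev σ i = some (f i)) ∧
          1 / 2 ^ c ≤ coinMeasure.real (S.segmentEvent m f)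
    refine (le_measureReal_iInter (m₀ := m₀) hB hBm fun m hm => ?_).trans
      (measureReal_mono ?_)
    · obtain ⟨L, hL⟩ := h m hm
      refine (mul_le_countStrings.1 hL).trans (measureReal_mono fun X (hX : _ = true) => ?_)
      have hd : S.definedTo m (X.take L) = true := by
        rw [heavy, Bool.and_eq_true] at hX
        exact hX.1
      obtain ⟨f, hf⟩ := definedTo_iff.1 hd
      exact ⟨f, ⟨L, hf⟩, ((heavy_iff hd ⟨L, hf⟩).1 hX).trans (measureReal_mono Set.inter_subset_right)⟩
    · intro X hX
      rw [Set.mem_iInter] at hX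
      choose F hF hFc using hX
      -- The segments chosen at different levels are all computed from the same `X`, so they cohere
      -- into one function.
      let f : ℕ → ℕ := fun n => F (n + 1) n
      have hfF : ∀ m, ∀ i < m, F m i = f i := fun m i hi =>
        segmentEvent_unique (m := i + 1) (segmentEvent_anti _ hi (hF m)) (hF (i + 1))
          (Nat.lt_succ_self i)
      have hseg : ∀ m, S.segmentEvent m (F m) = S.segmentEvent m f := fun m =>
        segmentEvent_congr (hfF m)
      refine atomEvent_subset c ⟨f, ?_, ?_⟩
      · change X ∈ {X | S.Computes X f}
        rw [setOf_computes_eq]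
        exact Set.mem_iInter.2 fun m => hseg m ▸ hF m
      · exact ge_of_tendsto' (tendsto_segmentEvent f) fun m => hseg m ▸ hFc m
  · intro r ε hε hr
    obtain ⟨c, hc⟩ := exists_lt_measureReal_of_iUnion monotone_atomEvent
      (hr.trans_le (measure_computableEvent_le (S := S)))
    -- Halving the threshold ensures that a segment of mass `2⁻ᶜ` failing the test has less than
    -- half of its mass visible.
    refine ⟨c + 1, fun m L hL => mul_le_countStrings.2 ?_⟩
    rw [← coinMeasure_real_take] at hL
    set V : Set BinSeq := {X | S.definedTo m (X.take L) = true} with hVdef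
    set U : Set BinSeq := {X | ∃ L, S.definedTo m (X.take L) = true} with hUdef
    have hVm : MeasurableSet V := measurableSet_take L fun σ => S.definedTo m σ = true
    have hVU : V ⊆ U := fun X hX => ⟨L, hX⟩
    have hdiff := measureReal_sdiff (μ := coinMeasure) hVU hVm
    -- Segments are indexed by `Fin m → ℕ` to have countably many pairwise disjoint classes; the
    -- padding by 0 is never consulted.
    let ext : (Fin m → ℕ) → ℕ → ℕ := fun s i => if h : i < m then s ⟨i, h⟩ else 0
    let E : (Fin m → ℕ) → Set BinSeq := fun s => S.segmentEvent m (ext s)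
    have hEd : Pairwise (Function.onFun Disjoint E) := fun s s' hne =>
      Set.disjoint_left.2 fun X hX hX' => hne (funext fun i => by
        simpa [ext] using segmentEvent_unique hX hX' i.2)
    have hEm : ∀ s, MeasurableSet (E s) := fun s => measurableSet_segmentEvent m _
    have hEf : ∀ f : ℕ → ℕ, S.segmentEvent m f = E fun i => f i := fun f =>
      segmentEvent_congr fun i hi => by simp [ext, hi]
    let bad : Set (Fin m → ℕ) := {s | 1 / 2 ^ c ≤ coinMeasure.real (E s) ∧
      coinMeasure.real (V ∩ E s) < 1 / 2 ^ (c + 1)}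
    have hbad : ∀ s ∈ bad, coinMeasure (V ∩ E s) ≤ coinMeasure (E s \ V) := by
      rintro s ⟨h1, h2⟩
      have hadd := measureReal_inter_add_sdiff (μ := coinMeasure) (s := E s) hVm
      rw [Set.inter_comm] at hadd
      have hpow : (1 : ℝ) / 2 ^ (c + 1) = 1 / 2 ^ c / 2 := by rw [pow_succ]; field_simp
      refine (ENNReal.toReal_le_toReal (measure_ne_top _ _) (measure_ne_top _ _)).1 ?_
      change coinMeasure.real _ ≤ coinMeasure.real _
      linarith
    -- The visible part of each bad segment is no larger than its invisible part, and the invisible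
    -- parts are disjoint subsets of `U \ V`. So infinitely many segments still cost at most one `ε`
    -- in total.
    have hbadU : coinMeasure.real (⋃ s ∈ bad, V ∩ E s) ≤ coinMeasure.real (U \ V) := by
      refine ENNReal.toReal_mono (measure_ne_top _ _) ((measure_biUnion_inter_le hEd hEm hVm
        hbad).trans (measure_mono (Set.sdiff_subset_sdiff_left ?_)))
      refine Set.iUnion_subset fun s X ⟨L, hL⟩ => ⟨L, definedTo_iff.2 ⟨_, hL⟩⟩
    have hsub : S.atomEvent c ⊆ ({X | S.heavy (c + 1) m (X.take L) = true} ∪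
        ⋃ s ∈ bad, V ∩ E s) ∪ (U \ V) := by
      rintro X ⟨f, hX, hf⟩
      have hXm : X ∈ S.segmentEvent m f := (Computes.eventually hX m).exists
      by_cases hd : S.definedTo m (X.take L) = true
      · refine Or.inl ?_
        by_cases hh : S.heavy (c + 1) m (X.take L) = true
        · exact Or.inl hh
        · refine Or.inr (Set.mem_biUnion (x := fun i : Fin m => f i) ⟨?_, ?_⟩ ⟨hd, hEf f ▸ hXm⟩)
          · rw [← hEf]
            refine hf.trans (measureReal_mono ?_)
            rw [setOf_computes_eq]
            exact Set.iInter_subset _ m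
          · rw [heavy_iff hd hXm, not_le] at hh
            rwa [← hEf]
      · obtain ⟨L', hL'⟩ := hXm
        exact Or.inr ⟨⟨L', definedTo_iff.2 ⟨f, hL'⟩⟩, hd⟩
    have h1 := (measureReal_mono (μ := coinMeasure) hsub).trans ((measureReal_union_le _ _).trans
      (add_le_add_left (measureReal_union_le _ _) _))
    linarith

end StagedMachine

end ComputableOutput

/-! ### Oracle machines and monotone machines as staged machines -/

section Machines

open Encodable Nat.Partrec MeasureTheory

/-- The staged machine which searches the prefixes of the oracle for a value of `g`. -/
def StagedMachine.ofSearch (g : ℕ → List Bool → ℕ → Option ℕ)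
    (hg : Primrec fun q : (ℕ × List Bool) × ℕ => g q.1.1 q.1.2 q.2)
    (hmono : ∀ {k l : ℕ} {σ : List Bool} {n v : ℕ}, k ≤ l → g k σ n = some v → g l σ n = some v)
    (hcons : ∀ {k l : ℕ} {σ τ : List Bool} {n a b : ℕ}, σ <+: τ → g k σ n = some a →
      g l τ n = some b → a = b) : StagedMachine where
  ev σ n := ((List.range (σ.length + 1)).filterMap fun i => g σ.length (σ.take i) n).head?
  primrec := by
    refine Primrec.list_head?.comp (Primrec.listFilterMap
      (f := fun q : List Bool × ℕ => List.range (q.1.length + 1)) (Primrec.list_range.comp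
      (Primrec.succ.comp (Primrec.list_length.comp Primrec.fst))) ?_)
    have h1 : Primrec fun q : (List Bool × ℕ) × ℕ => q.1.1 := Primrec.fst.comp Primrec.fst
    exact hg.comp (g := fun q : (List Bool × ℕ) × ℕ => ((q.1.1.length, q.1.1.take q.2), q.1.2))
      (((Primrec.list_length.comp h1).pair (Primrec.list_take.comp Primrec.snd h1)).pair
        (Primrec.snd.comp Primrec.fst))
  mono := by
    intro σ τ n v hστ hv
    obtain ⟨i, hi, hiv⟩ := List.mem_filterMap.1 (List.mem_of_head? hv)
    rw [List.mem_range, Nat.lt_succ_iff] at hi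
    obtain ⟨ρ, rfl⟩ := hστ
    rw [← List.take_append_of_le_length (l₂ := ρ) hi] at hiv
    have hiv' := hmono (by simp : σ.length ≤ (σ ++ ρ).length) hiv
    have hmem : v ∈ (List.range ((σ ++ ρ).length + 1)).filterMap
        fun i => g (σ ++ ρ).length ((σ ++ ρ).take i) n :=
      List.mem_filterMap.2 ⟨i, by simp; omega, hiv'⟩
    -- On the longer string the search may succeed first at another prefix; consistency forces the
    -- same value.
    cases hw : ((List.range ((σ ++ ρ).length + 1)).filterMap
        fun i => g (σ ++ ρ).length ((σ ++ ρ).take i) n).head? with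
    | none => rw [List.head?_eq_none_iff] at hw; exact absurd (hw ▸ hmem) List.not_mem_nil
    | some w =>
      obtain ⟨j, _, hjw⟩ := List.mem_filterMap.1 (List.mem_of_head? hw)
      rcases le_total i j with h | h
      · rw [hcons (List.take_prefix_take_left h) hiv' hjw]
      · rw [hcons (List.take_prefix_take_left h) hjw hiv']

theorem StagedMachine.exists_ev_ofSearch {g : ℕ → List Bool → ℕ → Option ℕ} {hg hmono hcons}
    {X : BinSeq} {n v : ℕ} :
    (∃ L, (StagedMachine.ofSearch g hg hmono hcons).ev (X.take L) n = some v) ↔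
      ∃ k i, g k (X.take i) n = some v := by
  constructor
  · rintro ⟨L, hL⟩
    obtain ⟨i, hi, hiv⟩ := List.mem_filterMap.1 (List.mem_of_head? hL)
    rw [List.mem_range, BinSeq.length_take, Nat.lt_succ_iff] at hi
    rw [X.take_take hi] at hiv
    exact ⟨_, i, hiv⟩
  · rintro ⟨k, i, h⟩
    refine ⟨max k i, ?_⟩
    have h1 := hmono (le_max_left k i) h
    have hmem : v ∈ (List.range ((X.take (max k i)).length + 1)).filterMap
        fun j => g (X.take (max k i)).length ((X.take (max k i)).take j) n := by
      refine List.mem_filterMap.2 ⟨i, by simp, ?_⟩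
      rwa [BinSeq.length_take, X.take_take (le_max_right k i)]
    change List.head? _ = _
    cases hw : ((List.range ((X.take (max k i)).length + 1)).filterMap
        fun j => g (X.take (max k i)).length ((X.take (max k i)).take j) n).head? with
    | none => rw [List.head?_eq_none_iff] at hw; exact absurd (hw ▸ hmem) List.not_mem_nil
    | some w =>
      obtain ⟨j, hj, hjw⟩ := List.mem_filterMap.1 (List.mem_of_head? hw)
      rw [List.mem_range, BinSeq.length_take, Nat.lt_succ_iff] at hj
      rw [X.take_take hj] at hjw
      rcases le_total i j with h' | h'
      · rw [hcons (X.take_prefix h') h hjw]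
      · rw [hcons (X.take_prefix h') hjw h]

/-- `Code.evaln` bounds the running time. The domain of `M` need not be closed under extension of
strings, which is why all prefixes are searched. -/
theorem OracleMachine.exists_staged (M : OracleMachine) :
    ∃ S : StagedMachine, ∀ X f, M.Computes X f ↔ S.Computes X f := by
  obtain ⟨c, hc⟩ := Code.exists_code.1 M.partrec
  have hev : ∀ σ n v, (∃ k, c.evaln k (encode (σ, n)) = some v) ↔ v ∈ M.toFun σ n := by
    intro σ n v
    have h := Code.evaln_complete (c := c) (n := encode (σ, n)) (x := v)
    rw [hc] at h
    simp only [encodek, Part.coe_some, Part.bind_some, Option.mem_def] at h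
    rw [← h]
    simp [Part.mem_map_iff]
  refine ⟨StagedMachine.ofSearch (fun k σ n => c.evaln k (encode (σ, n))) ?_
    (fun h => Code.evaln_mono h)
    (fun h h1 h2 => M.consistent h ((hev _ _ _).1 ⟨_, h1⟩) ((hev _ _ _).1 ⟨_, h2⟩)), ?_⟩
  · exact Code.primrec_evaln.comp (g := fun q : (ℕ × List Bool) × ℕ =>
      ((q.1.1, c), encode (q.1.2, q.2)))
      (((Primrec.fst.comp Primrec.fst).pair (Primrec.const c)).pair
        (Primrec.encode.comp ((Primrec.snd.comp Primrec.fst).pair Primrec.snd)))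
  · intro X f
    refine forall_congr' fun n => ?_
    rw [StagedMachine.exists_ev_ofSearch, exists_comm]
    exact exists_congr fun i => (hev _ _ _).symm

/-- The staged machine returns the `n`-th bit of any output string long enough to have one;
monotonicity makes it well defined. The bound by 1 lets a number-valued output be read back as a
stream. -/
theorem MonotoneMachine.exists_staged (N : MonotoneMachine) :
    ∃ S : StagedMachine, (∀ X f, N.Outputs X f ↔ S.Computes X fun n => (f n).toNat) ∧
      ∀ X f, S.Computes X f → ∀ n, f n ≤ 1 := by
  obtain ⟨c, hc⟩ := Code.exists_code.1 N.partrec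
  let g : ℕ → List Bool → ℕ → Option ℕ := fun k σ n =>
    (c.evaln k (encode σ)).bind fun e => (decode (α := List Bool) e).bind fun ρ =>
      ρ[n]?.map Bool.toNat
  have hev : ∀ σ n v, (∃ k, g k σ n = some v) ↔
      ∃ ρ ∈ N.toFun σ, ∃ b, ρ[n]? = some b ∧ b.toNat = v := by
    intro σ n v
    have h : ∀ e, (∃ k, c.evaln k (encode σ) = some e) ↔ ∃ ρ ∈ N.toFun σ, encode ρ = e := by
      intro e
      have h := Code.evaln_complete (c := c) (n := encode σ) (x := e)
      rw [hc] at h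
      simp only [encodek, Part.coe_some, Part.bind_some, Option.mem_def] at h
      rw [← h]
      simp [Part.mem_map_iff]
    simp only [g, Option.bind_eq_some_iff, Option.map_eq_some_iff]
    constructor
    · rintro ⟨k, e, he, ρ, hρ, b, hb⟩
      obtain ⟨ρ', hρ', rfl⟩ := (h e).1 ⟨k, he⟩
      rw [encodek, Option.some_inj] at hρ
      subst hρ
      exact ⟨ρ', hρ', b, hb⟩
    · rintro ⟨ρ, hρ, b, hb⟩
      obtain ⟨k, hk⟩ := (h _).2 ⟨ρ, hρ, rfl⟩
      exact ⟨k, _, hk, ρ, encodek ρ, b, hb⟩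
  have hcons : ∀ {σ τ ρ π : List Bool} {n : ℕ} {a b : Bool}, σ <+: τ → ρ ∈ N.toFun σ →
      π ∈ N.toFun τ → ρ[n]? = some a → π[n]? = some b → a = b := by
    intro σ τ ρ π n a b h hρ hπ ha hb
    obtain ⟨π', rfl⟩ := N.monotone h hρ hπ
    have hn : n < ρ.length := (List.getElem?_eq_some_iff.1 ha).1
    rw [List.getElem?_append_left hn, ha] at hb
    exact Option.some_injective _ hb
  have hcons' : ∀ {k l : ℕ} {σ τ : List Bool} {n a b : ℕ}, σ <+: τ → g k σ n = some a →
      g l τ n = some b → a = b := by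
    intro k l σ τ n a b h h1 h2
    obtain ⟨ρ, hρ, x, hx, rfl⟩ := (hev _ _ _).1 ⟨_, h1⟩
    obtain ⟨π, hπ, y, hy, rfl⟩ := (hev _ _ _).1 ⟨_, h2⟩
    rw [hcons h hρ hπ hx hy]
  have hmono : ∀ {k l : ℕ} {σ : List Bool} {n v : ℕ}, k ≤ l → g k σ n = some v →
      g l σ n = some v := by
    intro k l σ n v h hv
    obtain ⟨e, he, he'⟩ := Option.bind_eq_some_iff.1 hv
    exact Option.bind_eq_some_iff.2 ⟨e, Code.evaln_mono h he, he'⟩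
  have hprim : Primrec fun q : (ℕ × List Bool) × ℕ => g q.1.1 q.1.2 q.2 := by
    have h1 : Primrec fun q : (ℕ × List Bool) × ℕ => c.evaln q.1.1 (encode q.1.2) :=
      Code.primrec_evaln.comp (g := fun q : (ℕ × List Bool) × ℕ => ((q.1.1, c), encode q.1.2))
        (((Primrec.fst.comp Primrec.fst).pair (Primrec.const c)).pair
          (Primrec.encode.comp (Primrec.snd.comp Primrec.fst)))
    refine Primrec.option_bind h1 (Primrec.option_bind (Primrec.decode.comp Primrec.snd) ?_)
    exact Primrec.option_map (Primrec.list_getElem?.comp Primrec.snd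
      (Primrec.snd.comp (Primrec.fst.comp Primrec.fst)))
      ((Primrec.dom_bool Bool.toNat).comp Primrec.snd)
  have hval : ∀ (X : BinSeq) n v, (∃ L, (StagedMachine.ofSearch g hprim hmono hcons').ev (X.take L) n
      = some v) ↔ ∃ i, ∃ ρ ∈ N.toFun (X.take i), ∃ b, ρ[n]? = some b ∧ b.toNat = v := by
    intro X n v
    rw [StagedMachine.exists_ev_ofSearch, exists_comm]
    exact exists_congr fun i => hev _ _ _
  refine ⟨StagedMachine.ofSearch g hprim hmono hcons', fun X f => ⟨?_, ?_⟩, ?_⟩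
  · rintro ⟨h1, h2⟩ n
    obtain ⟨k, ρ, hρ, hn⟩ := h2 (n + 1)
    refine (hval X n _).2 ⟨k, ρ, hρ, f n, ?_, rfl⟩
    rw [h1 k ρ hρ, BinSeq.take_getElem?, if_pos (Nat.lt_of_succ_le hn)]
  · intro h
    have h' : ∀ n, ∃ i, ∃ ρ ∈ N.toFun (X.take i), ρ[n]? = some (f n) := by
      intro n
      obtain ⟨i, ρ, hρ, b, hb, hb'⟩ := (hval X n _).1 (h n)
      have hbf : b = f n := by cases b <;> cases hf : f n <;> simp [hf] at hb' ⊢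
      rw [hbf] at hb
      exact ⟨i, ρ, hρ, hb⟩
    refine ⟨fun k ρ hρ => List.ext_getElem (by simp) fun n h1 _ => ?_, fun n => ?_⟩
    · obtain ⟨i, π, hπ, hn⟩ := h' n
      have hρn : ρ[n]? = some ρ[n] := List.getElem?_eq_getElem h1
      have : ρ[n] = f n := by
        rcases le_total k i with hk | hk
        · exact hcons (X.take_prefix hk) hρ hπ hρn hn
        · exact (hcons (X.take_prefix hk) hπ hρ hn hρn).symm
      simp [this, BinSeq.take]
    · obtain ⟨i, ρ, hρ, hn⟩ := h' n
      exact ⟨i, ρ, hρ, (List.getElem?_eq_some_iff.1 hn).1.le⟩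
  · intro X f h n
    obtain ⟨i, ρ, _, b, _, hb⟩ := (hval X n _).1 (h n)
    rw [← hb]
    exact Bool.toNat_le b

theorem StagedMachine.events_spec (S : StagedMachine) :
    ((∃ P T : Set BinSeq, IsPi02Class P ∧ IsSigma02Class T ∧ S.cofiniteEvent = P ∩ T) ∧
      IsComputableRealIn zeroDoubleJump (coinMeasure.real S.cofiniteEvent) ∧
      ¬ IsThreeRandomReal (coinMeasure.real S.cofiniteEvent)) ∧
    (MeasurableSet S.computableEvent ∧
      IsComputableRealIn zeroDoubleJump (coinMeasure.real S.computableEvent) ∧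
      ¬ IsThreeRandomReal (coinMeasure.real S.computableEvent)) :=
  ⟨⟨S.cofiniteEvent_arithmetical, isComputableReal_cofiniteEvent,
    not_isThreeRandomReal measureReal_nonneg isComputableReal_cofiniteEvent⟩,
    S.measurableSet_computableEvent, isComputableReal_computableEvent,
    not_isThreeRandomReal measureReal_nonneg isComputableReal_computableEvent⟩

end Machines

theorem proposition1p4 :
    (∀ M : OracleMachine,
      ((∃ P S : Set BinSeq, IsPi02Class P ∧ IsSigma02Class S ∧ M.cofiniteEvent = P ∩ S) ∧
        IsComputableRealIn zeroDoubleJump (coinMeasure.real M.cofiniteEvent) ∧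
        ¬ IsThreeRandomReal (coinMeasure.real M.cofiniteEvent)) ∧
      (MeasurableSet M.computableEvent ∧
        IsComputableRealIn zeroDoubleJump (coinMeasure.real M.computableEvent) ∧
        ¬ IsThreeRandomReal (coinMeasure.real M.computableEvent))) ∧
    (∀ N : MonotoneMachine,
      ((∃ P S : Set BinSeq, IsPi02Class P ∧ IsSigma02Class S ∧ N.cofiniteEvent = P ∩ S) ∧
        IsComputableRealIn zeroDoubleJump (coinMeasure.real N.cofiniteEvent) ∧
        ¬ IsThreeRandomReal (coinMeasure.real N.cofiniteEvent)) ∧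
      (MeasurableSet N.computableEvent ∧
        IsComputableRealIn zeroDoubleJump (coinMeasure.real N.computableEvent) ∧
        ¬ IsThreeRandomReal (coinMeasure.real N.computableEvent))) := by
  refine ⟨fun M => ?_, fun N => ?_⟩
  · obtain ⟨S, hS⟩ := M.exists_staged
    have h1 : M.cofiniteEvent = S.cofiniteEvent := by
      ext X
      exact exists_congr fun A => and_congr_right fun _ => hS X _
    have h2 : M.computableEvent = S.computableEvent := by
      ext X
      exact exists_congr fun f => and_congr_right fun _ => hS X f
    rw [h1, h2]
    exact S.events_spec
  · obtain ⟨S, hS, hbit⟩ := N.exists_staged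
    have h1 : N.cofiniteEvent = S.cofiniteEvent := by
      ext X
      exact exists_congr fun A => and_congr_right fun _ => hS X _
    have h2 : N.computableEvent = S.computableEvent := by
      ext X
      constructor
      · rintro ⟨f, hf, hX⟩
        exact ⟨_, (Primrec.dom_bool Bool.toNat).to_comp.comp hf, (hS X f).1 hX⟩
      · rintro ⟨f, hf, hX⟩
        refine ⟨fun n => decide (f n = 1), ((Primrec.eq.comp Primrec.id
          (Primrec.const 1)).decide).to_comp.comp hf, (hS X _).2 ?_⟩
        -- All values are 0 or 1, so passing to bits and back changes nothing.
        have : (fun n => (decide (f n = 1)).toNat) = f := funext fun n => by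
          have := hbit X f hX n
          interval_cases h : f n <;> rfl
        rwa [this]
    rw [h1, h2]
    exact S.events_spec
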